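/- Let $M$ be a von Neumann algebra with a faithful normal tracial state $\tau$, let $N_1,N_2\subseteq M$ be von Neumann subalgebras (with the same unit) that together generate $M$ as a von Neumann algebra, and suppose that the von Neumann algebra $N_1\cap N_2$ is diffuse (has no minimal projection). If $N_1$ and $N_2$ are finitely generated and $\mathfrak K_2(N_1)=\mathfrak K_2(N_2)=0$, computed with the restrictions of $\tau$, then $M$ is finitely generated and $\mathfrak K_2(M)=0$. Here the upper free orbit-dimension $\mathfrak K_2$ is defined as follows. Let $\tau_k$ be the normalized trace on $M_k(\mathbb C)$ and $\|(A_1,\dots,A_n)\|_2^2=\sum_j\tau_k(A_j^*A_j)$. For $x_1,\dots,x_n$ in a von Neumann algebra $N$ with tracial state $\tau$, $R,\epsilon>0$ and $m,k\in\mathbb N$, let $\Gamma_R(x_1,\dots,x_n;m,k,\epsilon)$ be the set of all $(A_1,\dots,A_n)\in M_k(\mathbb C)^n$ with operator norms $\|A_j\|\le R$ and $$|\tau_k(A_{i_1}^{\eta_1}\cdots A_{i_q}^{\eta_q})-\tau(x_{i_1}^{\eta_1}\cdots x_{i_q}^{\eta_q})|<\epsilon$$ for all $1\le q\le m$, $1\le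 i_1,\dots,i_q\le n$ and $\eta_1,\dots,\eta_q\in\{1,*\}$. For $\omega>0$ the $\omega$-orbit-ball centered at $(B_1,\dots,B_n)$ is the set of all $(A_1,\dots,A_n)$ such that $\|(A_1-WB_1W^*,\dots,A_n-WB_nW^*)\|_2<\omega$ for some unitary $W\in M_k(\mathbb C)$, and $\nu(\Gamma,\omega)$ is the minimal number of $\omega$-orbit-balls with centers in $\Gamma$ that cover $\Gamma$. Put $$\mathfrak K(x_1,\dots,x_n;\omega,R)=\inf_{m\in\mathbb N,\ \epsilon>0}\ \limsup_{k\to\infty}\frac{\log \nu(\Gamma_R(x_1,\dots,x_n;m,k,\epsilon),\omega)}{-k^2\log\omega},$$ $$\mathfrak K_2(x_1,\dots,x_n)=\sup_{0<\omega<1}\ \sup_{R>0}\ \mathfrak K(x_1,\dots,x_n;\omega,R),$$ where an empty set $\Gamma_R(x_1,\dots,x_n;m,k,\epsilon)$ contributes $0$ (that is, $\log 0$ is read as $0$, so that $\mathfrak K\ge 0$). Finally, for finitely generated $N$, $\mathfrak K_2(N)$ is the supremum of $\mathfrak K_2(x_1,\dots,x_n)$ over all finite families $x_1,\dots,x_n$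 that generate $N$ as a von Neumann algebra. -/

import Mathlib

open scoped InnerProductSpace ComplexOrder Matrix

namespace FreeOrbit

universe u

noncomputable section

/-! ### Matrix microstates and orbit covering numbers -/

/-- The `*`-monomial `x_{i₁}^{η₁} ⋯ x_{i_q}^{η_q}` described by the list of pairs `(i_j, η_j)`,
where `η_j = true` stands for the adjoint and `η_j = false` for no adjoint. -/
def starWord {A : Type*} [Monoid A] [Star A] {n : ℕ} (x : Fin n → A)
    (w : List (Fin n × Bool)) : A :=
  (w.map fun p => if p.2 then star (x p.1) else x p.1).prod

/-- The normalized trace `τ_k = (1/k) Tr` on `M_k(ℂ)`. -/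
def normTrace {k : ℕ} (A : Matrix (Fin k) (Fin k) ℂ) : ℂ :=
  A.trace / (k : ℂ)

/-- The trace norm `‖(A₁, …, Aₙ)‖₂ = (∑ⱼ τ_k(Aⱼ* Aⱼ))^{1/2}` on `M_k(ℂ)ⁿ`. -/
def norm₂ {n k : ℕ} (A : Fin n → Matrix (Fin k) (Fin k) ℂ) : ℝ :=
  Real.sqrt (∑ j, (normTrace ((A j)ᴴ * A j)).re)

/-- The `ω`-orbit-ball centered at `(B₁, …, Bₙ)`: all tuples at `‖·‖₂`-distance less than `ω`
from some unitary conjugate `(W B₁ W*, …, W Bₙ W*)`. -/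
def orbitBall {n k : ℕ} (B : Fin n → Matrix (Fin k) (Fin k) ℂ) (ω : ℝ) :
    Set (Fin n → Matrix (Fin k) (Fin k) ℂ) :=
  {A | ∃ W ∈ Matrix.unitaryGroup (Fin k) ℂ, norm₂ (fun j => A j - W * B j * Wᴴ) < ω}

/-- The microstate set `Γ_R(x₁, …, xₙ; m, k, ε)`, where the moments of `x₁, …, xₙ` are computed
with the functional `τ`. The bound `‖Aⱼ‖ ≤ R` is on the operator norm over Euclidean space. -/
def microstates {A : Type*} [Monoid A] [Star A] (τ : A → ℂ) {n : ℕ} (x : Fin n → A)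
    (R : ℝ) (m k : ℕ) (ε : ℝ) : Set (Fin n → Matrix (Fin k) (Fin k) ℂ) :=
  {a | (∀ j, ‖Matrix.toEuclideanCLM (n := Fin k) (𝕜 := ℂ) (a j)‖ ≤ R) ∧
    ∀ w : List (Fin n × Bool), 1 ≤ w.length → w.length ≤ m →
      ‖normTrace (starWord a w) - τ (starWord x w)‖ < ε}

/-- The `ω`-orbit covering number `ν(Γ, ω)`: the minimal number of `ω`-orbit-balls with centers
in `Γ` that cover `Γ`. (Finite covers exist for norm-bounded `Γ` and `ω > 0`.) -/
def orbitCoveringNumber {n k : ℕ} (Γ : Set (Fin n → Matrix (Fin k) (Fin k) ℂ)) (ω : ℝ) : ℕ :=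
  sInf {N | ∃ S : Finset (Fin n → Matrix (Fin k) (Fin k) ℂ),
    S.card = N ∧ (S : Set (Fin n → Matrix (Fin k) (Fin k) ℂ)) ⊆ Γ ∧
      Γ ⊆ ⋃ B ∈ S, orbitBall B ω}

/-! ### Free orbit-dimension of a tuple -/

/-- `𝔎(x₁, …, xₙ; ω, R)`, the infimum over `m` and `ε > 0` of the limit superior as `k → ∞` of
`log ν(Γ_R(x₁, …, xₙ; m, k, ε), ω) / (-k² log ω)`. An empty microstate set contributes `0` (the
quantity is nonnegative by convention), which is the meaning of `max ν 1`: as soon as the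
microstate set is nonempty one has `ν ≥ 1` and the maximum is `ν`. -/
def orbitDimAt {A : Type*} [Monoid A] [Star A] (τ : A → ℂ) {n : ℕ} (x : Fin n → A)
    (ω R : ℝ) : EReal :=
  ⨅ (m : ℕ) (ε : ℝ) (_ : 0 < ε),
    Filter.limsup (fun k : ℕ =>
      ((Real.log ((max (orbitCoveringNumber (microstates τ x R m k ε) ω) 1 : ℕ) : ℝ) /
        (-(k : ℝ) ^ 2 * Real.log ω) : ℝ) : EReal)) Filter.atTop

/-- The upper free orbit-dimension `𝔎₂(x₁, …, xₙ)`, the supremum over `0 < ω < 1` of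
`𝔎(x₁, …, xₙ; ω)`, which is the supremum over `R > 0` of `𝔎(x₁, …, xₙ; ω, R)`. -/
def upperOrbitDim {A : Type*} [Monoid A] [Star A] (τ : A → ℂ) {n : ℕ} (x : Fin n → A) : EReal :=
  ⨆ (ω : ℝ) (_ : 0 < ω) (_ : ω < 1), ⨆ (R : ℝ) (_ : 0 < R), orbitDimAt τ x ω R

/-! ### Von Neumann algebras -/

variable {H : Type u} [NormedAddCommGroup H] [InnerProductSpace ℂ H] [CompleteSpace H]

/-- `N` is generated by `S` as a von Neumann algebra: it is the smallest von Neumann algebra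
on `H` that contains `S`. -/
def IsGeneratedBy (N : VonNeumannAlgebra H) (S : Set (H →L[ℂ] H)) : Prop :=
  IsLeast {P : VonNeumannAlgebra H | S ⊆ P} N

/-- The upper free orbit-dimension `𝔎₂(N)` of a von Neumann algebra `N` with tracial state `τ`,
the supremum of `𝔎₂(x₁, …, xₙ)` over all finite families that generate `N`. For an `N` that is
not finitely generated the supremum is empty, hence `⊥`; so `𝔎₂(N) = 0` includes that `N` is
finitely generated. -/
def upperFreeOrbitDimension (N : VonNeumannAlgebra H) (τ : N.toStarSubalgebra →ₗ[ℂ] ℂ) : EReal :=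
  ⨆ (n : ℕ) (x : Fin n → N.toStarSubalgebra)
    (_ : IsGeneratedBy N (Set.range fun j => (x j : H →L[ℂ] H))), upperOrbitDim τ x

/-- The restriction to a von Neumann subalgebra `N` of a functional on `M`. -/
def restrictTo {N M : VonNeumannAlgebra H} (h : N ≤ M) (τ : M.toStarSubalgebra →ₗ[ℂ] ℂ) :
    N.toStarSubalgebra →ₗ[ℂ] ℂ where
  toFun a := τ ⟨a, h a.2⟩
  map_add' a b := τ.map_add ⟨a, h a.2⟩ ⟨b, h b.2⟩
  map_smul' c a := τ.map_smul c ⟨a, h a.2⟩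

/-- The ultraweak topology on `B(H)`: the coarsest topology making all the functionals
`T ↦ ∑ᵢ ⟪ξᵢ, T ηᵢ⟫` with `∑ᵢ ‖ξᵢ‖² < ∞` and `∑ᵢ ‖ηᵢ‖² < ∞` continuous. -/
@[reducible]
def ultraweakTopology (H : Type u) [NormedAddCommGroup H] [InnerProductSpace ℂ H] :
    TopologicalSpace (H →L[ℂ] H) :=
  ⨅ (ξ : ℕ → H) (η : ℕ → H) (_ : Summable fun i => ‖ξ i‖ ^ 2) (_ : Summable fun i => ‖η i‖ ^ 2),
    TopologicalSpace.induced (fun T : H →L[ℂ] H => ∑' i, ⟪ξ i, T (η i)⟫_ℂ) inferInstance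

/-- `τ` is a faithful normal tracial state on the von Neumann algebra `M`
(normal means ultraweakly continuous). -/
structure IsTracialState (M : VonNeumannAlgebra H) (τ : M.toStarSubalgebra →ₗ[ℂ] ℂ) : Prop where
  map_one : τ 1 = 1
  nonneg : ∀ a, 0 ≤ τ (star a * a)
  faithful : ∀ a, τ (star a * a) = 0 → a = 0
  tracial : ∀ a b, τ (a * b) = τ (b * a)
  normal : @Continuous M.toStarSubalgebra ℂ
    (TopologicalSpace.induced (fun a => (a : H →L[ℂ] H)) (ultraweakTopology H)) inferInstance τ

/-- The intersection of two von Neumann algebras on `H`, as a von Neumann algebra. -/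
def inter (N₁ N₂ : VonNeumannAlgebra H) : VonNeumannAlgebra H where
  toStarSubalgebra := N₁.toStarSubalgebra ⊓ N₂.toStarSubalgebra
  centralizer_centralizer' := by
    refine Set.Subset.antisymm (fun a ha => ⟨?_, ?_⟩) Set.subset_centralizer_centralizer
    · have h : a ∈ Set.centralizer (Set.centralizer (N₁ : Set (H →L[ℂ] H))) :=
        Set.centralizer_subset (Set.centralizer_subset fun x hx => hx.1) ha
      rwa [N₁.centralizer_centralizer] at h
    · have h : a ∈ Set.centralizer (Set.centralizer (N₂ : Set (H →L[ℂ] H))) :=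
        Set.centralizer_subset (Set.centralizer_subset fun x hx => hx.2) ha
      rwa [N₂.centralizer_centralizer] at h

/-- A von Neumann algebra is diffuse if it has no minimal projection: below every nonzero
projection there is a nonzero, strictly smaller one. -/
def IsDiffuse (N : VonNeumannAlgebra H) : Prop :=
  ∀ p ∈ N, IsStarProjection p → p ≠ 0 →
    ∃ q ∈ N, IsStarProjection q ∧ q * p = q ∧ q ≠ 0 ∧ q ≠ p

end

end FreeOrbit

/-!
The upper free orbit-dimension of a tuple vanishes exactly when its matrix microstates of size `k`
can, modulo unitary conjugation and up to a small `2`-norm error, be colored with `exp (α k²)`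
colors for every `α > 0` (`NegligibleOrbits`). So let `x` and `z` be finite generating families of
the two subalgebras `N₁` and `N₂` with this property, and let `y` be any finite generating family
of `M`. The task is to color the microstates `a` of `y` with few colors.

By Kaplansky density (`boundedApprox_of_dense`) `x` and `z` are `2`-norm limits of `*`-polynomials
in `y` that are uniformly bounded, also on matrix tuples. Hence a microstate `a` of `y` determines
microstates `X a` of `x` and `Z a` of `z`, while conversely `a ≈ Q (X a, Z a)` for `*`-polynomials
`Q`, because `x` and `z` together generate `M`. By assumption few colors suffice to fix the orbits
of `X a` and of `Z a`. Relative to a base point `a₀` of a color class, `X a ≈ U X(a₀) U*` and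
`Z a ≈ V Z(a₀) V*`, so that `a` is, up to conjugation by `U`, determined by the base point and the
single unitary `T = U* V` (`colorable_of_almost_commutant`).

This is where the diffuse intersection enters. It contains a partition of unity into projections
`e_l` with `∑ τ(e_l)²` as small as desired (`exists_fine_partition`). Each `e_l` is a limit of
`*`-polynomials `f_l` in `x` and also of `*`-polynomials `g_l` in `z`; as `f_l(X a) ≈ g_l(Z a)` for
all microstates, `T` almost commutes with `F_l = f_l(X a₀)`. These matrices nearly are orthogonal
projections of small trace with sum `1`, so `T ≈ ∑ F_l T F_l` lies near a space whose dimension is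
a small multiple of `k²`, and volume packing colors such `T` with few colors
(`exists_colorable_almost_commutant`). Together this is `negligibleOrbits_of_amalgam`, which is
stated for tracial states on arbitrary C⋆-algebras.

Von Neumann algebras enter only through the double commutant theorem in the ultrastrong topology
(`exists_amplify_sub_lt`), which together with the normality of `τ` makes the `*`-polynomials in
generators `2`-norm dense (`exists_twoNorm_sub_eval_le`), and through the suprema of projections
needed for the partitions of unity.
-/

namespace FreeOrbit

universe u

noncomputable section

open Filter Topology

/-! ### The `2`-norm of a tracial state on a C⋆-algebra -/

/-- A tracial state on a unital C⋆-algebra. Neither faithfulness nor normality is required, so that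
this applies to von Neumann algebras and to full matrix algebras alike. -/
structure IsTrace {A : Type*} [CStarAlgebra A] (τ : A →ₗ[ℂ] ℂ) : Prop where
  map_one : τ 1 = 1
  nonneg : ∀ a, 0 ≤ τ (star a * a)
  tracial : ∀ a b, τ (a * b) = τ (b * a)

/-- The `2`-norm `‖a‖₂ = τ(a* a)^{1/2}`. -/
def twoNorm {A : Type*} [CStarAlgebra A] (τ : A →ₗ[ℂ] ℂ) (a : A) : ℝ :=
  Real.sqrt (τ (star a * a)).re

section TwoNorm

variable {A : Type*} [CStarAlgebra A] {τ : A →ₗ[ℂ] ℂ}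

lemma IsTrace.map_star (hτ : IsTrace τ) (a : A) : τ (star a) = star (τ a) := by
  have real (h : A) (hh : star h = h) : (τ h).im = 0 := by
    have e : h = (4⁻¹ : ℂ) • (star (h + 1) * (h + 1) - star (h - 1) * (h - 1)) := by
      simp only [star_add, star_sub, hh, star_one, mul_add, add_mul, mul_sub, sub_mul, mul_one,
        one_mul]
      have : h * h + h + (h + 1) - (h * h - h - (h - 1)) = (4 : ℂ) • h := by
        rw [show (4 : ℂ) = 1 + 1 + 1 + 1 by norm_num]
        simp only [add_smul, one_smul]; abel
      rw [this, smul_smul]; norm_num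
    rw [e, map_smul, map_sub]
    have h1 := (Complex.nonneg_iff.1 (hτ.nonneg (h + 1))).2
    have h2 := (Complex.nonneg_iff.1 (hτ.nonneg (h - 1))).2
    simp [Complex.mul_im, -star_add, -star_sub, ← h1, ← h2]
  have h1 := real (a + star a) (by simp [add_comm])
  have h2 := real (Complex.I • (a - star a)) (by simp [smul_sub, neg_add_eq_sub])
  simp only [map_add, map_smul, map_sub, Complex.add_im, smul_eq_mul, Complex.mul_im,
    Complex.I_re, Complex.I_im, Complex.sub_re, zero_mul, one_mul, zero_add] at h1 h2
  apply Complex.ext <;> simp <;> linarith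

/-- The pre-inner product `⟨a, b⟩ = τ(a* b)` of a tracial state. -/
@[reducible]
def IsTrace.core (hτ : IsTrace τ) : PreInnerProductSpace.Core ℂ A where
  inner a b := τ (star a * b)
  conj_inner_symm a b := by
    have := hτ.map_star (star b * a)
    simp only [star_mul, star_star] at this
    rw [this]; rfl
  re_inner_nonneg a := (Complex.nonneg_iff.1 (hτ.nonneg a)).1
  add_left a b c := by simp [add_mul]
  smul_left a b c := by simp

lemma twoNorm_nonneg (a : A) : 0 ≤ twoNorm τ a := Real.sqrt_nonneg _

lemma IsTrace.twoNorm_sq (hτ : IsTrace τ) (a : A) : twoNorm τ a ^ 2 = (τ (star a * a)).re :=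
  Real.sq_sqrt (Complex.nonneg_iff.1 (hτ.nonneg a)).1

lemma IsTrace.twoNorm_add_le (hτ : IsTrace τ) (a b : A) :
    twoNorm τ (a + b) ≤ twoNorm τ a + twoNorm τ b := by
  let c := hτ.core
  let _ := @InnerProductSpace.Core.toSeminormedAddCommGroup ℂ A _ _ _ c
  exact norm_add_le a b

lemma IsTrace.norm_apply_star_mul_le (hτ : IsTrace τ) (a b : A) :
    ‖τ (star a * b)‖ ≤ twoNorm τ a * twoNorm τ b :=
  @InnerProductSpace.Core.norm_inner_le_norm ℂ A _ _ _ hτ.core a b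

lemma twoNorm_neg (a : A) : twoNorm τ (-a) = twoNorm τ a := by simp [twoNorm]

@[simp] lemma twoNorm_zero : twoNorm τ (0 : A) = 0 := by simp [twoNorm]

lemma twoNorm_sub_comm (a b : A) : twoNorm τ (a - b) = twoNorm τ (b - a) := by
  rw [← twoNorm_neg, neg_sub]

lemma IsTrace.twoNorm_sub_le (hτ : IsTrace τ) (a b c : A) :
    twoNorm τ (a - c) ≤ twoNorm τ (a - b) + twoNorm τ (b - c) := by
  simpa using hτ.twoNorm_add_le (a - b) (b - c)

lemma twoNorm_smul (c : ℂ) (a : A) : twoNorm τ (c • a) = ‖c‖ * twoNorm τ a := by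
  have : star (c • a) * (c • a) = ((‖c‖ ^ 2 : ℝ) : ℂ) • (star a * a) := by
    rw [star_smul, smul_mul_smul_comm]
    congr 1
    simpa using Complex.conj_mul' c
  rw [twoNorm, this, map_smul, smul_eq_mul, Complex.re_ofReal_mul, Real.sqrt_mul (sq_nonneg _),
    Real.sqrt_sq (norm_nonneg _), twoNorm]

lemma IsTrace.twoNorm_star (hτ : IsTrace τ) (a : A) : twoNorm τ (star a) = twoNorm τ a := by
  rw [twoNorm, star_star, hτ.tracial, twoNorm]

lemma IsTrace.twoNorm_mul_le (hτ : IsTrace τ) (a b : A) :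
    twoNorm τ (a * b) ≤ ‖a‖ * twoNorm τ b := by
  let _ := CStarAlgebra.spectralOrder A
  have _ := CStarAlgebra.spectralOrderedRing A
  obtain ⟨c, hc⟩ := CStarAlgebra.nonneg_iff_eq_star_mul_self.1
    (sub_nonneg.2 (CStarAlgebra.star_mul_le_algebraMap_norm_sq (a := a)))
  have e : star (a * b) * (a * b)
      = ((‖a‖ ^ 2 : ℝ) : ℂ) • (star b * b) - star (c * b) * (c * b) := by
    have : star (c * b) * (c * b) = star b * (star c * c) * b := by simp [mul_assoc]
    rw [this, ← hc]
    have h2 : algebraMap ℝ A (‖a‖ ^ 2) = algebraMap ℂ A ((‖a‖ ^ 2 : ℝ) : ℂ) := by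
      rw [Algebra.algebraMap_eq_smul_one, Algebra.algebraMap_eq_smul_one, Complex.coe_smul]
    rw [h2, Algebra.algebraMap_eq_smul_one]
    simp [mul_sub, sub_mul, mul_assoc]
  have h := (Complex.nonneg_iff.1 (hτ.nonneg (c * b))).1
  rw [twoNorm, e, map_sub, map_smul, twoNorm]
  rw [← Real.sqrt_sq (norm_nonneg a), ← Real.sqrt_mul (sq_nonneg _)]
  apply Real.sqrt_le_sqrt
  rw [Complex.sub_re, smul_eq_mul, Complex.re_ofReal_mul, Real.sqrt_sq (norm_nonneg a)]
  linarith

lemma IsTrace.twoNorm_mul_le' (hτ : IsTrace τ) (a b : A) :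
    twoNorm τ (a * b) ≤ twoNorm τ a * ‖b‖ := by
  rw [← hτ.twoNorm_star, star_mul, mul_comm (twoNorm τ a), ← hτ.twoNorm_star a, ← norm_star b]
  exact hτ.twoNorm_mul_le _ _

lemma IsTrace.twoNorm_one (hτ : IsTrace τ) : twoNorm τ 1 = 1 := by
  simp [twoNorm, hτ.map_one]

lemma IsTrace.twoNorm_le_norm (hτ : IsTrace τ) (a : A) : twoNorm τ a ≤ ‖a‖ := by
  simpa [hτ.twoNorm_one] using hτ.twoNorm_mul_le a 1

lemma IsTrace.norm_apply_le (hτ : IsTrace τ) (a : A) : ‖τ a‖ ≤ twoNorm τ a := by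
  simpa [hτ.twoNorm_one] using hτ.norm_apply_star_mul_le 1 a

lemma IsTrace.twoNorm_sum_le (hτ : IsTrace τ) {ι : Type*} (s : Finset ι) (f : ι → A) :
    twoNorm τ (∑ i ∈ s, f i) ≤ ∑ i ∈ s, twoNorm τ (f i) := by
  classical
  induction s using Finset.induction_on with
  | empty => simp
  | insert i s hi ih =>
    rw [Finset.sum_insert hi, Finset.sum_insert hi]
    exact (hτ.twoNorm_add_le _ _).trans (by gcongr)

/-- Multiplication is Lipschitz for the `2`-norm on norm-bounded sets. -/
lemma IsTrace.twoNorm_mul_sub_mul_le (hτ : IsTrace τ) (a b a' b' : A) :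
    twoNorm τ (a * b - a' * b') ≤ ‖b‖ * twoNorm τ (a - a') + ‖a'‖ * twoNorm τ (b - b') := by
  have e : a * b - a' * b' = (a - a') * b + a' * (b - b') := by
    simp [sub_mul, mul_sub]
  rw [e, mul_comm ‖b‖]
  exact (hτ.twoNorm_add_le _ _).trans (add_le_add (hτ.twoNorm_mul_le' _ _) (hτ.twoNorm_mul_le _ _))

lemma norm_le_one_of_mem_unitary {u : A} (hu : u ∈ unitary A) : ‖u‖ ≤ 1 := by
  have h : ‖u‖ * ‖u‖ = ‖(1 : A)‖ := by
    rw [← CStarRing.norm_star_mul_self, (Unitary.mem_iff.1 hu).1]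
  nontriviality A
  rw [norm_one] at h
  nlinarith [norm_nonneg u]

lemma norm_conj_le {u a : A} (hu : u ∈ unitary A) {C : ℝ} (ha : ‖a‖ ≤ C) :
    ‖u * a * star u‖ ≤ C := by
  have h1 := norm_le_one_of_mem_unitary hu
  have h2 := norm_le_one_of_mem_unitary (Unitary.star_mem hu)
  have h3 : ‖u * a‖ ≤ C := (norm_mul_le _ _).trans
    ((mul_le_of_le_one_left (norm_nonneg _) h1).trans ha)
  exact (norm_mul_le _ _).trans ((mul_le_of_le_one_right (norm_nonneg _) h2).trans h3)

lemma IsTrace.twoNorm_conj_le (hτ : IsTrace τ) {u : A} (hu : u ∈ unitary A) (a : A) :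
    twoNorm τ (u * a * star u) ≤ twoNorm τ a := by
  have h1 := norm_le_one_of_mem_unitary hu
  have h2 := norm_le_one_of_mem_unitary (Unitary.star_mem hu)
  have n := twoNorm_nonneg (τ := τ) a
  calc twoNorm τ (u * a * star u) ≤ twoNorm τ (u * a) * ‖star u‖ := hτ.twoNorm_mul_le' _ _
    _ ≤ twoNorm τ (u * a) * 1 := by gcongr; exact twoNorm_nonneg _
    _ ≤ ‖u‖ * twoNorm τ a * 1 := by gcongr; exact hτ.twoNorm_mul_le _ _
    _ ≤ 1 * twoNorm τ a * 1 := by gcongr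
    _ = _ := by ring

end TwoNorm

/-! ### Noncommutative `*`-polynomials -/

/-- Formal expressions for `*`-polynomials in noncommuting variables indexed by `ι`. As a syntax
type it can be evaluated in `*`-algebras of every universe, in particular both in a von Neumann
algebra and in matrix algebras. -/
inductive StarPoly (ι : Type) : Type
  | var : ι → StarPoly ι
  | const : ℂ → StarPoly ι
  | add : StarPoly ι → StarPoly ι → StarPoly ι
  | mul : StarPoly ι → StarPoly ι → StarPoly ι
  | adj : StarPoly ι → StarPoly ι

namespace StarPoly

variable {ι κ : Type}

/-- Evaluation of a `*`-polynomial at a family of elements of a `*`-algebra. -/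
def eval {A : Type*} [Ring A] [StarRing A] [Algebra ℂ A] (a : ι → A) : StarPoly ι → A
  | var i => a i
  | const c => algebraMap ℂ A c
  | add P Q => eval a P + eval a Q
  | mul P Q => eval a P * eval a Q
  | adj P => star (eval a P)

/-- Substitution of `*`-polynomials for the variables. -/
def subst (S : ι → StarPoly κ) : StarPoly ι → StarPoly κ
  | var i => S i
  | const c => const c
  | add P Q => add (subst S P) (subst S Q)
  | mul P Q => mul (subst S P) (subst S Q)
  | adj P => adj (subst S P)

/-- A bound for the norm of the values at families bounded by `R`. -/
def bound (R : ℝ) : StarPoly ι → ℝ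
  | var _ => R
  | const c => ‖c‖
  | add P Q => bound R P + bound R Q
  | mul P Q => bound R P * bound R Q
  | adj P => bound R P

/-- A Lipschitz constant for the `2`-norm on families bounded by `R`. -/
def lip (R : ℝ) : StarPoly ι → ℝ
  | var _ => 1
  | const _ => 0
  | add P Q => lip R P + lip R Q
  | mul P Q => bound R Q * lip R P + bound R P * lip R Q
  | adj P => lip R P

/-- The difference of two `*`-polynomials. -/
def sub (P Q : StarPoly ι) : StarPoly ι := add P (mul (const (-1)) Q)

/-- The sum of a finite family of `*`-polynomials. -/
def finSum {r : ℕ} (P : Fin r → StarPoly ι) : StarPoly ι :=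
  (List.ofFn P).foldr add (const 0)

/-- The power `P ^ n`. -/
def npow (P : StarPoly ι) : ℕ → StarPoly ι
  | 0 => const 1
  | n + 1 => mul (npow P n) P

/-- The composition `f(P)` with a real one-variable polynomial `f`. -/
def comp (f : Polynomial ℝ) (P : StarPoly ι) : StarPoly ι :=
  finSum fun i : Fin (f.natDegree + 1) => mul (const (f.coeff i : ℂ)) (npow P i)

/-- The real part `(P + P*) / 2`. -/
def realPart (P : StarPoly ι) : StarPoly ι := mul (const (2⁻¹ : ℂ)) (add P (adj P))

/-- The `*`-monomial described by a word. -/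
def word {n : ℕ} : List (Fin n × Bool) → StarPoly (Fin n)
  | [] => const 1
  | p :: w => mul (if p.2 then adj (var p.1) else var p.1) (word w)

/-- The expansion of a `*`-polynomial as a linear combination of words. -/
def expand {n : ℕ} : StarPoly (Fin n) → List (ℂ × List (Fin n × Bool))
  | var i => [(1, [(i, false)])]
  | const c => [(c, [])]
  | add P Q => expand P ++ expand Q
  | mul P Q => (expand P).flatMap fun p => (expand Q).map fun q => (p.1 * q.1, p.2 ++ q.2)
  | adj P => (expand P).map fun p => (star p.1, (p.2.map fun l => (l.1, !l.2)).reverse)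

section Eval

variable {A : Type*} [Ring A] [StarRing A] [Algebra ℂ A]

lemma eval_subst (S : ι → StarPoly κ) (a : κ → A) (P : StarPoly ι) :
    eval a (subst S P) = eval (fun i => eval a (S i)) P := by
  induction P <;> simp_all [subst, eval]

@[simp] lemma eval_sub (a : ι → A) (P Q : StarPoly ι) :
    eval a (sub P Q) = eval a P - eval a Q := by
  simp [sub, eval, sub_eq_add_neg]

@[simp] lemma eval_finSum {r : ℕ} (a : ι → A) (P : Fin r → StarPoly ι) :
    eval a (finSum P) = ∑ i, eval a (P i) := by
  rw [finSum, ← List.sum_ofFn]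
  have (l : List (StarPoly ι)) : eval a (l.foldr add (const 0)) = (l.map (eval a)).sum := by
    induction l <;> simp_all [eval]
  rw [this, List.map_ofFn]; rfl

@[simp] lemma eval_npow (a : ι → A) (P : StarPoly ι) (n : ℕ) :
    eval a (npow P n) = eval a P ^ n := by
  induction n with
  | zero => simp [npow, eval]
  | succ n ih => simp [npow, eval, ih, pow_succ]

lemma eval_comp (a : ι → A) (f : Polynomial ℝ) (P : StarPoly ι) :
    eval a (comp f P) = Polynomial.aeval (eval a P) (f.map (algebraMap ℝ ℂ)) := by
  rw [Polynomial.aeval_eq_sum_range' (n := f.natDegree + 1)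
    (Nat.lt_succ_of_le (Polynomial.natDegree_map_le)), comp, eval_finSum, Finset.sum_range]
  simp [eval, Algebra.smul_def]

@[simp] lemma eval_realPart (a : ι → A) (P : StarPoly ι) :
    eval a (realPart P) = (2⁻¹ : ℂ) • (eval a P + star (eval a P)) := by
  simp [realPart, eval, Algebra.smul_def]

lemma isSelfAdjoint_eval_realPart [StarModule ℂ A] (a : ι → A) (P : StarPoly ι) :
    IsSelfAdjoint (eval a (realPart P)) := by
  simp [IsSelfAdjoint, add_comm]

@[simp] lemma eval_word {n : ℕ} (a : Fin n → A) (w : List (Fin n × Bool)) :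
    eval a (word w) = starWord a w := by
  induction w with
  | nil => simp [word, eval, starWord]
  | cons p w ih =>
    rw [word, eval, ih]
    simp only [starWord, List.map_cons, List.prod_cons]
    congr 1
    split_ifs <;> rfl

lemma starWord_append {A : Type*} [Monoid A] [Star A] {n : ℕ} (a : Fin n → A)
    (v w : List (Fin n × Bool)) :
    starWord a (v ++ w) = starWord a v * starWord a w := by
  simp [starWord]

lemma star_starWord {A : Type*} [Monoid A] [StarMul A] {n : ℕ} (a : Fin n → A)
    (w : List (Fin n × Bool)) :
    star (starWord a w) = starWord a (w.map fun l => (l.1, !l.2)).reverse := by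
  induction w with
  | nil => simp [starWord]
  | cons p w ih =>
    have : starWord a (p :: w) = (if p.2 then star (a p.1) else a p.1) * starWord a w := by
      simp [starWord]
    rw [this, star_mul, ih, List.map_cons, List.reverse_cons, starWord, starWord, List.map_append,
      List.prod_append]
    congr 1
    cases p.2 <;> simp

/-- The value of a `*`-polynomial is the linear combination of monomials given by its expansion. -/
lemma eval_eq_sum_expand [StarModule ℂ A] {n : ℕ} (a : Fin n → A) (P : StarPoly (Fin n)) :
    eval a P = ((expand P).map fun p => p.1 • starWord a p.2).sum := by
  induction P with
  | var i => simp [expand, eval, starWord]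
  | const c => simp [expand, eval, starWord, Algebra.algebraMap_eq_smul_one]
  | add P Q hP hQ => simp [expand, eval, hP, hQ]
  | mul P Q hP hQ =>
    rw [eval, hP, hQ, expand]
    generalize expand P = p
    induction p with
    | nil => simp
    | cons x p ih =>
      rw [List.map_cons, List.sum_cons, add_mul, ih, List.flatMap_cons, List.map_append,
        List.sum_append, List.map_map]
      congr 1
      generalize expand Q = q
      induction q with
      | nil => simp
      | cons y q ih =>
        simp only [List.map_cons, List.sum_cons, mul_add, ih, Function.comp, starWord_append,
          smul_mul_smul_comm]
  | adj P hP =>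
    rw [eval, hP, expand]
    generalize expand P = p
    induction p with
    | nil => simp
    | cons x p ih => simp [ih, star_starWord]

lemma eval_conj {u : A} (hu : u ∈ unitary A) (a : ι → A) (P : StarPoly ι) :
    eval (fun i => u * a i * star u) P = u * eval a P * star u := by
  have h1 : star u * u = 1 := (Unitary.mem_iff.1 hu).1
  have h2 : u * star u = 1 := (Unitary.mem_iff.1 hu).2
  induction P with
  | var i => rfl
  | const c => rw [eval, eval, ← Algebra.commutes, mul_assoc, h2, mul_one]
  | add P Q hP hQ => simp [eval, hP, hQ, mul_add, add_mul]
  | mul P Q hP hQ =>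
    rw [eval, eval, hP, hQ]
    simp only [mul_assoc]
    rw [← mul_assoc (star u) u, h1, one_mul]
  | adj P hP => rw [eval, eval, hP]; simp [mul_assoc]

end Eval

section CStar

variable {A : Type*} [CStarAlgebra A] {R : ℝ} {a b : ι → A}

lemma bound_nonneg (hR : 0 ≤ R) (P : StarPoly ι) : 0 ≤ bound R P := by
  induction P <;> (simp only [bound]; positivity)

lemma lip_nonneg (hR : 0 ≤ R) (P : StarPoly ι) : 0 ≤ lip R P := by
  induction P with
  | mul P Q hP hQ =>
    have := bound_nonneg hR P
    have := bound_nonneg hR Q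
    simp only [lip]; positivity
  | _ => simp only [lip]; positivity

lemma norm_eval_le [Nontrivial A] (hR : 0 ≤ R) (ha : ∀ i, ‖a i‖ ≤ R) (P : StarPoly ι) :
    ‖eval a P‖ ≤ bound R P := by
  induction P with
  | var i => exact ha i
  | const c => simp [eval, bound, norm_algebraMap']
  | add P Q hP hQ => exact (norm_add_le _ _).trans (add_le_add hP hQ)
  | mul P Q hP hQ =>
    exact (norm_mul_le _ _).trans (mul_le_mul hP hQ (norm_nonneg _) (bound_nonneg hR P))
  | adj P hP => rwa [eval, norm_star]

lemma twoNorm_eval_sub_le [Nontrivial A] {τ : A →ₗ[ℂ] ℂ} (hτ : IsTrace τ) (hR : 0 ≤ R)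
    (ha : ∀ i, ‖a i‖ ≤ R) (hb : ∀ i, ‖b i‖ ≤ R) {δ : ℝ}
    (hab : ∀ i, twoNorm τ (a i - b i) ≤ δ) (P : StarPoly ι) :
    twoNorm τ (eval a P - eval b P) ≤ lip R P * δ := by
  induction P with
  | var i => simpa [eval, lip] using hab i
  | const c => simp [eval, lip]
  | add P Q hP hQ =>
    rw [eval, eval, add_sub_add_comm, lip, add_mul]
    exact (hτ.twoNorm_add_le _ _).trans (add_le_add hP hQ)
  | mul P Q hP hQ =>
    refine (hτ.twoNorm_mul_sub_mul_le _ _ _ _).trans ?_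
    rw [lip, add_mul, mul_assoc, mul_assoc]
    have h1 := norm_eval_le hR ha Q
    have h2 := norm_eval_le hR hb P
    exact add_le_add (mul_le_mul h1 hP (twoNorm_nonneg _) (bound_nonneg hR Q))
      (mul_le_mul h2 hQ (twoNorm_nonneg _) (bound_nonneg hR P))
  | adj P hP => rwa [eval, eval, ← star_sub, hτ.twoNorm_star]

end CStar

end StarPoly

section

open scoped Matrix.Norms.L2Operator

/-! ### Matrix microstates and evaluation of `*`-polynomials -/

/-- The normalized trace on `M_k(ℂ)` as a linear functional. -/
def matTrace (k : ℕ) : Matrix (Fin k) (Fin k) ℂ →ₗ[ℂ] ℂ :=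
  (k : ℂ)⁻¹ • Matrix.traceLinearMap (Fin k) ℂ ℂ

lemma matTrace_apply {k : ℕ} (A : Matrix (Fin k) (Fin k) ℂ) : matTrace k A = normTrace A := by
  simp [matTrace, normTrace, div_eq_inv_mul]

lemma isTrace_matTrace {k : ℕ} (hk : 0 < k) : IsTrace (matTrace k) where
  map_one := by
    have : (k : ℂ) ≠ 0 := by exact_mod_cast hk.ne'
    simp [matTrace, this]
  nonneg A := by
    rw [matTrace, LinearMap.smul_apply, smul_eq_mul]
    refine mul_nonneg ?_ (Matrix.posSemidef_conjTranspose_mul_self A).trace_nonneg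
    rw [inv_nonneg]
    exact_mod_cast k.zero_le
  tracial A B := by simp [matTrace, Matrix.trace_mul_comm A B]

lemma nontrivial_matrix {k : ℕ} (hk : 0 < k) : Nontrivial (Matrix (Fin k) (Fin k) ℂ) := by
  have : Nonempty (Fin k) := ⟨⟨0, hk⟩⟩
  infer_instance

section Micro

variable {A : Type*} [CStarAlgebra A] {τ : A →ₗ[ℂ] ℂ} {n p : ℕ}

lemma microstates_mono {y : Fin n → A} {R R' : ℝ} (hR : R ≤ R') {m m' k : ℕ} (hm : m' ≤ m)
    {ε ε' : ℝ} (hε : ε ≤ ε') : microstates τ y R m k ε ⊆ microstates τ y R' m' k ε' :=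
  fun _ ha => ⟨fun j => (ha.1 j).trans hR,
    fun w h1 h2 => (ha.2 w h1 (h2.trans hm)).trans_le hε⟩

/-- The filter of matrix tuples (of all sizes) bounded by `R` whose `*`-moments tend to those
of `y`. A property holds eventually along it iff it holds on all microstate sets of high enough
degree and precision, in all positive dimensions. -/
def microFilter (τ : A →ₗ[ℂ] ℂ) (y : Fin n → A) (R : ℝ) :
    Filter (Σ k : ℕ, Fin n → Matrix (Fin k) (Fin k) ℂ) :=
  ⨅ m : ℕ, 𝓟 {s | 0 < s.1 ∧ s.2 ∈ microstates τ y R m s.1 (1 / ((m : ℝ) + 1))}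

lemma eventually_microFilter {y : Fin n → A} {R : ℝ}
    {q : (Σ k : ℕ, Fin n → Matrix (Fin k) (Fin k) ℂ) → Prop} :
    (∀ᶠ s in microFilter τ y R, q s) ↔ ∃ m : ℕ, ∀ k : ℕ, 0 < k →
      ∀ a ∈ microstates τ y R m k (1 / ((m : ℝ) + 1)), q ⟨k, a⟩ := by
  rw [microFilter, (hasBasis_iInf_principal (directed_of_isDirected_le ?_)).eventually_iff]
  · simp only [true_and]
    exact exists_congr fun m => ⟨fun h k hk a ha => h ⟨hk, ha⟩, fun h s hs => h s.1 hs.1 s.2 hs.2⟩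
  · intro m m' h s hs
    exact ⟨hs.1, microstates_mono le_rfl h (one_div_le_one_div_of_le (by positivity)
      (by gcongr)) hs.2⟩

lemma eventually_pos_microFilter (τ : A →ₗ[ℂ] ℂ) (y : Fin n → A) (R : ℝ) :
    ∀ᶠ s in microFilter τ y R, 0 < s.1 :=
  eventually_microFilter.2 ⟨0, fun _ hk _ _ => hk⟩

lemma eventually_norm_le_microFilter (τ : A →ₗ[ℂ] ℂ) (y : Fin n → A) (R : ℝ) :
    ∀ᶠ s in microFilter τ y R, ∀ j, ‖s.2 j‖ ≤ R :=
  eventually_microFilter.2 ⟨0, fun _ _ _ ha => ha.1⟩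

lemma tendsto_starWord_microFilter (hτ : IsTrace τ) (y : Fin n → A) (R : ℝ)
    (w : List (Fin n × Bool)) :
    Tendsto (fun s => matTrace s.1 (starWord s.2 w)) (microFilter τ y R)
      (𝓝 (τ (starWord y w))) := by
  rw [Metric.tendsto_nhds]
  intro ε hε
  rcases Nat.eq_zero_or_pos w.length with h0 | h0
  · filter_upwards [eventually_pos_microFilter τ y R] with s hs
    rw [List.length_eq_zero_iff.1 h0]
    simpa [starWord, hτ.map_one, (isTrace_matTrace hs).map_one] using hε
  · obtain ⟨m, hm⟩ := exists_nat_one_div_lt hε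
    refine eventually_microFilter.2 ⟨max m w.length, fun k _ a ha => ?_⟩
    rw [dist_eq_norm, matTrace_apply]
    refine (ha.2 w h0 (le_max_right _ _)).trans (lt_of_le_of_lt ?_ hm)
    exact one_div_le_one_div_of_le (by positivity) (by gcongr; exact le_max_left _ _)

/-- Traces of `*`-polynomials in the microstates converge to the trace at `y`. -/
lemma tendsto_eval_microFilter (hτ : IsTrace τ) (y : Fin n → A) (R : ℝ) (P : StarPoly (Fin n)) :
    Tendsto (fun s => matTrace s.1 (P.eval s.2)) (microFilter τ y R) (𝓝 (τ (P.eval y))) := by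
  simp only [StarPoly.eval_eq_sum_expand]
  induction P.expand with
  | nil => simpa using tendsto_const_nhds
  | cons x l ih =>
    simp only [List.map_cons, List.sum_cons, map_add, map_smul]
    exact ((tendsto_starWord_microFilter hτ y R x.2).const_smul x.1).add ih

lemma tendsto_twoNorm_microFilter (hτ : IsTrace τ) (y : Fin n → A) (R : ℝ)
    (P : StarPoly (Fin n)) :
    Tendsto (fun s => twoNorm (matTrace s.1) (P.eval s.2)) (microFilter τ y R)
      (𝓝 (twoNorm τ (P.eval y))) :=
  (Real.continuous_sqrt.tendsto _).comp ((Complex.continuous_re.tendsto _).comp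
    (tendsto_eval_microFilter hτ y R (.mul (.adj P) P)))

/-- A strict bound on the `2`-norm of a `*`-polynomial in `y` passes to microstates. -/
lemma eventually_twoNorm_lt (hτ : IsTrace τ) {y : Fin n → A} (R : ℝ)
    {P : StarPoly (Fin n)} {c : ℝ} (h : twoNorm τ (P.eval y) < c) :
    ∀ᶠ s in microFilter τ y R, twoNorm (matTrace s.1) (P.eval s.2) < c :=
  (tendsto_twoNorm_microFilter hτ y R P).eventually_lt_const h

lemma eventually_add_mul_lt (a L : ℝ) {c : ℝ} (h : a < c) :
    ∀ᶠ δ in 𝓝[>] (0 : ℝ), a + L * δ < c := by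
  have : Tendsto (fun δ : ℝ => a + L * δ) (𝓝[>] 0) (𝓝 (a + L * 0)) :=
    ((continuous_const.add (continuous_const.mul continuous_id)).tendsto 0).mono_left
      nhdsWithin_le_nhds
  rw [mul_zero, add_zero] at this
  exact this.eventually_lt_const h

/-- A strict bound on the `2`-norm of a `*`-polynomial in a family `w` passes to microstates of `y`
when the `w i` are replaced by close enough `*`-polynomials `P i` in `y`. -/
lemma eventually_twoNorm_eval_lt {ι : Type} [Nontrivial A] (hτ : IsTrace τ) (y : Fin n → A) (R : ℝ)
    {w : ι → A} {C : ℝ} (hC : 0 ≤ C) (hw : ∀ i, ‖w i‖ ≤ C) (S : StarPoly ι) {c : ℝ}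
    (h : twoNorm τ (S.eval w) < c) :
    ∀ᶠ δ in 𝓝[>] (0 : ℝ), ∀ P : ι → StarPoly (Fin n), (∀ i, ‖(P i).eval y‖ ≤ C) →
      (∀ i, twoNorm τ (w i - (P i).eval y) ≤ δ) →
      ∀ᶠ s in microFilter τ y R,
        twoNorm (matTrace s.1) (S.eval fun i => (P i).eval s.2) < c := by
  filter_upwards [eventually_add_mul_lt _ (S.lip C) h] with δ hδ P hPy hPw
  simp only [← StarPoly.eval_subst]
  refine eventually_twoNorm_lt hτ R (lt_of_le_of_lt ?_ hδ)
  rw [StarPoly.eval_subst]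
  have h1 := StarPoly.twoNorm_eval_sub_le hτ hC hw hPy hPw S
  have h2 := hτ.twoNorm_sub_le (S.eval fun i => (P i).eval y) (S.eval w) 0
  rw [sub_zero, sub_zero, twoNorm_sub_comm] at h2
  linarith

/-- If the `*`-polynomials `P j` in `y` are close to `x j` in `2`-norm and uniformly bounded, then
they map microstates of `y` to microstates of `x`. -/
lemma eventually_eval_mem_microstates [Nontrivial A] (hτ : IsTrace τ) (y : Fin n → A) (R : ℝ)
    {x : Fin p → A} {C : ℝ} (hC : 0 ≤ C) (hx : ∀ j, ‖x j‖ ≤ C) (m : ℕ) {ε : ℝ} (hε : 0 < ε) :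
    ∀ᶠ δ in 𝓝[>] (0 : ℝ), ∀ P : Fin p → StarPoly (Fin n),
      (∀ j, ‖(P j).eval y‖ ≤ C) → (∀ j, twoNorm τ (x j - (P j).eval y) ≤ δ) →
      (∀ (k : ℕ), 0 < k → ∀ a : Fin n → Matrix (Fin k) (Fin k) ℂ, (∀ i, ‖a i‖ ≤ R) →
        ∀ j, ‖(P j).eval a‖ ≤ C) →
      ∀ᶠ s in microFilter τ y R, (fun j => (P j).eval s.2) ∈ microstates τ x C m s.1 ε := by
  have fin : {w : List (Fin p × Bool) | w.length ≤ m}.Finite := List.finite_length_le _ m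
  have h1 : ∀ᶠ δ in 𝓝[>] (0 : ℝ), ∀ w ∈ {w : List (Fin p × Bool) | w.length ≤ m},
      (StarPoly.word w).lip C * δ < ε := by
    rw [eventually_all_finite fin]
    intro w _
    simpa using eventually_add_mul_lt 0 _ hε
  filter_upwards [h1] with δ hδ P hPy hPx hPa
  have h2 : ∀ᶠ s in microFilter τ y R, ∀ w ∈ {w : List (Fin p × Bool) | w.length ≤ m},
      ‖matTrace s.1 (starWord (fun j => (P j).eval s.2) w) - τ (starWord x w)‖ < ε := by
    rw [eventually_all_finite fin]
    intro w hw
    have t := tendsto_eval_microFilter hτ y R ((StarPoly.word w).subst P)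
    simp only [StarPoly.eval_subst, StarPoly.eval_word] at t
    refine ((t.sub_const (τ (starWord x w))).norm).eventually_lt_const ?_
    refine lt_of_le_of_lt ?_ (hδ w hw)
    rw [← map_sub, ← StarPoly.eval_word, ← StarPoly.eval_word]
    refine (hτ.norm_apply_le _).trans
      (StarPoly.twoNorm_eval_sub_le hτ hC hPy hx (fun j => ?_) _)
    rw [twoNorm_sub_comm]; exact hPx j
  filter_upwards [h2, eventually_norm_le_microFilter τ y R, eventually_pos_microFilter τ y R]
    with s hs hb hk
  refine ⟨fun j => hPa s.1 hk s.2 hb j, fun w _ hw => ?_⟩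
  rw [← matTrace_apply]
  exact hs w hw

end Micro

/-! ### Orbit covering numbers as colorings -/

/-- The set `s` can be colored with at most `B` colors so that any two elements of the same color
are related by `r`. -/
def Colorable {X : Type*} (s : Set X) (r : X → X → Prop) (B : ℝ) : Prop :=
  ∃ (c : X → ℕ) (t : Finset ℕ), (∀ a ∈ s, c a ∈ t) ∧ (t.card : ℝ) ≤ B ∧
    ∀ a ∈ s, ∀ b ∈ s, c a = c b → r a b

lemma Colorable.of_finset {X ι : Type*} {s : Set X} {r : X → X → Prop} {B : ℝ} (c : X → ι)
    (t : Finset ι) (hc : ∀ a ∈ s, c a ∈ t) (ht : (t.card : ℝ) ≤ B)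
    (hr : ∀ a ∈ s, ∀ b ∈ s, c a = c b → r a b) : Colorable s r B := by
  classical
  refine ⟨fun a => if h : c a ∈ t then (t.equivFin ⟨c a, h⟩ : ℕ) else 0, Finset.range t.card,
    fun a ha => ?_, by simpa using ht, fun a ha b hb hab => hr a ha b hb ?_⟩
  · simp [hc a ha]
  · simp only [hc a ha, hc b hb, dite_true] at hab
    simpa using t.equivFin.injective (Fin.ext hab)

lemma Colorable.mono {X : Type*} {s s' : Set X} {r r' : X → X → Prop} {B B' : ℝ}
    (h : Colorable s r B) (hs : s' ⊆ s) (hr : ∀ a ∈ s', ∀ b ∈ s', r a b → r' a b) (hB : B ≤ B') :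
    Colorable s' r' B' := by
  obtain ⟨c, t, h1, h2, h3⟩ := h
  exact ⟨c, t, fun a ha => h1 a (hs ha), h2.trans hB,
    fun a ha b hb e => hr a ha b hb (h3 a (hs ha) b (hs hb) e)⟩

lemma Colorable.comap {X Y : Type*} {s : Set X} {r : X → X → Prop} {B : ℝ} (h : Colorable s r B)
    {s' : Set Y} (f : Y → X) (hf : ∀ a ∈ s', f a ∈ s) :
    Colorable s' (fun a b => r (f a) (f b)) B := by
  obtain ⟨c, t, h1, h2, h3⟩ := h
  exact ⟨c ∘ f, t, fun a ha => h1 _ (hf a ha), h2,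
    fun a ha b hb e => h3 _ (hf a ha) _ (hf b hb) e⟩

/-- Refining a coloring on each of its color classes multiplies the numbers of colors. -/
lemma Colorable.fiberwise {X : Type*} {s : Set X} {r₀ r : X → X → Prop} {B₀ B : ℝ} (hB : 0 ≤ B)
    (h₀ : Colorable s r₀ B₀)
    (h : ∀ s' ⊆ s, (∀ a ∈ s', ∀ b ∈ s', r₀ a b) → Colorable s' r B) :
    Colorable s r (B₀ * B) := by
  obtain ⟨c, t, h1, h2, h3⟩ := h₀
  choose d u hd hu hr using fun i => h {a ∈ s | c a = i} (fun a ha => ha.1)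
    fun a ha b hb => h3 a ha.1 b hb.1 (ha.2.trans hb.2.symm)
  refine .of_finset (fun a => (⟨c a, d (c a) a⟩ : Σ _ : ℕ, ℕ)) (t.sigma u)
    (fun a ha => Finset.mem_sigma.2 ⟨h1 a ha, hd _ a ⟨ha, rfl⟩⟩) ?_ fun a ha b hb e => ?_
  · rw [Finset.card_sigma]
    push_cast
    calc ∑ i ∈ t, ((u i).card : ℝ) ≤ ∑ i ∈ t, B := Finset.sum_le_sum fun i _ => hu i
      _ = t.card * B := by simp
      _ ≤ B₀ * B := by gcongr
  · obtain ⟨e1, e2⟩ := Sigma.mk.inj e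
    have e2 := eq_of_heq e2
    exact hr (c a) a ⟨ha, rfl⟩ b ⟨hb, e1.symm⟩ (by rw [e2, e1])

/-- Two tuples of matrices are `ω`-orbit-close if each entry of the first is at `2`-distance less
than `ω` from the corresponding entry of a unitary conjugate of the second. -/
def OrbitClose {n k : ℕ} (ω : ℝ) (a b : Fin n → Matrix (Fin k) (Fin k) ℂ) : Prop :=
  ∃ W ∈ Matrix.unitaryGroup (Fin k) ℂ, ∀ j, twoNorm (matTrace k) (a j - W * b j * Wᴴ) < ω

/-- The microstate spaces of `y` have complexity `exp (o(k²))` modulo unitary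
conjugation; this is the coloring form of `𝔎₂(y) ≤ 0`. -/
def NegligibleOrbits {A : Type*} [Monoid A] [Star A] (τ : A → ℂ) {n : ℕ} (y : Fin n → A) : Prop :=
  ∀ R > 0, ∀ ω > 0, ∀ α > 0, ∃ m : ℕ, ∃ ε > 0, ∀ᶠ k : ℕ in atTop,
    Colorable (microstates τ y R m k ε) (OrbitClose ω) (Real.exp (α * (k : ℝ) ^ 2))

section Orbit

variable {n k : ℕ}

lemma norm₂_eq (a : Fin n → Matrix (Fin k) (Fin k) ℂ) (hk : 0 < k) :
    norm₂ a = Real.sqrt (∑ j, twoNorm (matTrace k) (a j) ^ 2) := by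
  simp only [(isTrace_matTrace hk).twoNorm_sq, matTrace_apply]; rfl

lemma twoNorm_le_norm₂ (hk : 0 < k) (a : Fin n → Matrix (Fin k) (Fin k) ℂ) (j : Fin n) :
    twoNorm (matTrace k) (a j) ≤ norm₂ a := by
  rw [norm₂_eq a hk]
  exact Real.le_sqrt_of_sq_le (Finset.single_le_sum
    (f := fun j => twoNorm (matTrace k) (a j) ^ 2) (fun _ _ => sq_nonneg _) (Finset.mem_univ j))

lemma norm₂_lt (hk : 0 < k) {ω : ℝ} (hω : 0 < ω) {a : Fin n → Matrix (Fin k) (Fin k) ℂ}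
    (h : ∀ j, twoNorm (matTrace k) (a j) < ω / (n + 1)) : norm₂ a < ω := by
  rw [norm₂_eq a hk]
  calc Real.sqrt (∑ j, twoNorm (matTrace k) (a j) ^ 2)
      ≤ Real.sqrt ((∑ j, twoNorm (matTrace k) (a j)) ^ 2) :=
        Real.sqrt_le_sqrt (Finset.sum_sq_le_sq_sum_of_nonneg fun _ _ => twoNorm_nonneg _)
    _ = ∑ j, twoNorm (matTrace k) (a j) :=
        Real.sqrt_sq (Finset.sum_nonneg fun _ _ => twoNorm_nonneg _)
    _ ≤ ∑ _j : Fin n, ω / (n + 1) := Finset.sum_le_sum fun j _ => (h j).le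
    _ = n * (ω / (n + 1)) := by simp
    _ < ω := by
        rw [mul_div_assoc', div_lt_iff₀ (by positivity)]
        nlinarith

lemma OrbitClose.trans_symm {ω : ℝ} (hk : 0 < k) {a a' b : Fin n → Matrix (Fin k) (Fin k) ℂ}
    (h : OrbitClose ω a b) (h' : OrbitClose ω a' b) : OrbitClose (2 * ω) a a' := by
  obtain ⟨W, hW, h⟩ := h
  obtain ⟨V, hV, h'⟩ := h'
  have hτ := isTrace_matTrace hk
  have hU : W * Vᴴ ∈ Matrix.unitaryGroup (Fin k) ℂ := mul_mem hW (Unitary.star_mem hV)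
  refine ⟨W * Vᴴ, hU, fun j => ?_⟩
  have e : W * b j * Wᴴ - W * Vᴴ * a' j * (W * Vᴴ)ᴴ
      = W * Vᴴ * (V * b j * Vᴴ - a' j) * star (W * Vᴴ) := by
    have hV' : Vᴴ * V = 1 := (Unitary.mem_iff.1 hV).1
    simp only [Matrix.star_eq_conjTranspose, Matrix.conjTranspose_mul,
      Matrix.conjTranspose_conjTranspose, mul_sub, sub_mul]
    congr 1
    calc W * b j * Wᴴ = W * 1 * b j * 1 * Wᴴ := by simp
      _ = _ := by rw [← hV']; simp only [mul_assoc]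
  refine (hτ.twoNorm_sub_le _ (W * b j * Wᴴ) _).trans_lt ?_
  rw [e, two_mul]
  refine add_lt_add (h j) ((hτ.twoNorm_conj_le hU _).trans_lt ?_)
  rw [twoNorm_sub_comm]; exact h' j

/-- A norm-bounded set of matrix tuples has a finite cover by orbit balls centered in the set. -/
lemma exists_finset_orbitBall_cover (hk : 0 < k) {Γ : Set (Fin n → Matrix (Fin k) (Fin k) ℂ)}
    {R : ℝ} (hΓ : ∀ a ∈ Γ, ∀ j, ‖a j‖ ≤ R) {ω : ℝ} (hω : 0 < ω) :
    ∃ S : Finset (Fin n → Matrix (Fin k) (Fin k) ℂ),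
      (S : Set (Fin n → Matrix (Fin k) (Fin k) ℂ)) ⊆ Γ ∧ Γ ⊆ ⋃ B ∈ S, orbitBall B ω := by
  have hb : Bornology.IsBounded Γ := by
    refine (Metric.isBounded_closedBall (x := 0) (r := max R 0)).subset fun a ha => ?_
    rw [mem_closedBall_zero_iff, pi_norm_le_iff_of_nonneg (le_max_right _ _)]
    exact fun j => (hΓ a ha j).trans (le_max_left _ _)
  have : ProperSpace (Fin n → Matrix (Fin k) (Fin k) ℂ) := FiniteDimensional.proper ℂ _
  have ht : TotallyBounded Γ := hb.isCompact_closure.totallyBounded.subset subset_closure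
  obtain ⟨t, htΓ, hf, hc⟩ := Metric.finite_approx_of_totallyBounded ht (ω / (n + 1))
    (by positivity)
  refine ⟨hf.toFinset, by simpa using htΓ, fun a ha => ?_⟩
  obtain ⟨b, hb, hab⟩ := Set.mem_iUnion₂.1 (hc ha)
  refine Set.mem_iUnion₂.2 ⟨b, by simpa using hb, 1, one_mem _, norm₂_lt hk hω fun j => ?_⟩
  rw [Metric.mem_ball, dist_eq_norm] at hab
  simpa using ((isTrace_matTrace hk).twoNorm_le_norm _).trans_lt
    ((norm_le_pi_norm (a - b) j).trans_lt hab)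

lemma colorable_of_orbitCoveringNumber (hk : 0 < k)
    {Γ : Set (Fin n → Matrix (Fin k) (Fin k) ℂ)}
    {R : ℝ} (hΓ : ∀ a ∈ Γ, ∀ j, ‖a j‖ ≤ R) {ω : ℝ} (hω : 0 < ω) :
    Colorable Γ (OrbitClose (2 * ω)) (orbitCoveringNumber Γ ω) := by
  obtain ⟨S₀, h1, h2⟩ := exists_finset_orbitBall_cover hk hΓ hω
  obtain ⟨S, hS, -, hc⟩ := Nat.sInf_mem (s := {N | ∃ S : Finset (Fin n → Matrix (Fin k) (Fin k) ℂ),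
    S.card = N ∧ (S : Set (Fin n → Matrix (Fin k) (Fin k) ℂ)) ⊆ Γ ∧
      Γ ⊆ ⋃ B ∈ S, orbitBall B ω}) ⟨_, S₀, rfl, h1, h2⟩
  have hc' (a) (ha : a ∈ Γ) : ∃ b ∈ S, a ∈ orbitBall b ω := by
    simpa using Set.mem_iUnion₂.1 (hc ha)
  choose! c hcS hcb using hc'
  refine .of_finset c S hcS (by rw [hS]; rfl) fun a ha b hb e => ?_
  obtain ⟨W, hW, h⟩ := hcb a ha
  obtain ⟨V, hV, h'⟩ := hcb b hb
  rw [← e] at h'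
  exact OrbitClose.trans_symm hk
    ⟨W, hW, fun j => (twoNorm_le_norm₂ hk (fun j => a j - W * c a j * Wᴴ) j).trans_lt h⟩
    ⟨V, hV, fun j => (twoNorm_le_norm₂ hk (fun j => b j - V * c a j * Vᴴ) j).trans_lt h'⟩

lemma Colorable.orbitCoveringNumber_le (hk : 0 < k) {Γ : Set (Fin n → Matrix (Fin k) (Fin k) ℂ)}
    {ω : ℝ} (hω : 0 < ω) {B : ℝ} (h : Colorable Γ (OrbitClose (ω / (n + 1))) B) :
    (orbitCoveringNumber Γ ω : ℝ) ≤ B := by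
  classical
  obtain ⟨c, t, h1, h2, h3⟩ := h
  have hrep (i : ℕ) : ∃ b, (∃ a ∈ Γ, c a = i) → b ∈ Γ ∧ c b = i := by
    by_cases h : ∃ a ∈ Γ, c a = i
    · exact ⟨h.choose, fun _ => h.choose_spec⟩
    · exact ⟨0, fun h' => absurd h' h⟩
  choose b hb using hrep
  set S := (t.filter fun i => ∃ a ∈ Γ, c a = i).image b
  have hS : S.card ≤ t.card := Finset.card_image_le.trans (Finset.card_filter_le _ _)
  refine le_trans ?_ h2
  have : orbitCoveringNumber Γ ω ≤ S.card := by
    refine Nat.sInf_le ⟨S, rfl, ?_, fun a ha => ?_⟩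
    · intro x hx
      obtain ⟨i, hi, rfl⟩ := Finset.mem_image.1 hx
      exact (hb i (Finset.mem_filter.1 hi).2).1
    · have hi : ∃ a' ∈ Γ, c a' = c a := ⟨a, ha, rfl⟩
      refine Set.mem_iUnion₂.2 ⟨b (c a), Finset.mem_image_of_mem _
        (Finset.mem_filter.2 ⟨h1 a ha, hi⟩), ?_⟩
      obtain ⟨W, hW, h⟩ := h3 a ha (b (c a)) (hb _ hi).1 (hb _ hi).2.symm
      exact ⟨W, hW, norm₂_lt hk hω h⟩
  exact_mod_cast this.trans hS

end Orbit

section Dimension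

variable {A : Type*} [Monoid A] [Star A] {τ : A → ℂ} {n : ℕ} {y : Fin n → A}

lemma upperOrbitDim_nonneg (τ : A → ℂ) (y : Fin n → A) : 0 ≤ upperOrbitDim τ y := by
  refine le_trans ?_ (le_iSup₂_of_le (1 / 2 : ℝ) (by norm_num) (le_iSup_of_le (by norm_num)
    (le_iSup₂_of_le (1 : ℝ) one_pos le_rfl)))
  refine le_iInf fun m => le_iInf₂ fun ε _ => ?_
  refine le_limsup_of_frequently_le (Eventually.frequently (Eventually.of_forall fun k => ?_))
  have h1 : 0 ≤
      Real.log ((max (orbitCoveringNumber (microstates τ y 1 m k ε) (1 / 2)) 1 : ℕ) : ℝ) :=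
    Real.log_nonneg (by exact_mod_cast le_max_right _ _)
  have h2 : Real.log (1 / 2) ≤ 0 := Real.log_nonpos (by norm_num) (by norm_num)
  exact EReal.coe_nonneg.2 (div_nonneg h1 (by nlinarith [sq_nonneg (k : ℝ)]))

lemma negligibleOrbits_of_upperOrbitDim_le_zero (h : upperOrbitDim τ y ≤ 0) :
    NegligibleOrbits τ y := by
  intro R hR ω hω α hα
  set ω₀ := min ω 1 / 2 with hω₀
  have hm : 0 < min ω 1 := lt_min hω one_pos
  have h0 : 0 < ω₀ := half_pos hm
  have h1 : ω₀ < 1 := by linarith [min_le_right ω 1]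
  have hlog : Real.log ω₀ < 0 := Real.log_neg h0 h1
  have hc : 0 < α / (-Real.log ω₀) := div_pos hα (neg_pos.2 hlog)
  have hd : orbitDimAt τ y ω₀ R < ((α / (-Real.log ω₀) : ℝ) : EReal) := by
    refine lt_of_le_of_lt ?_ (EReal.coe_pos.2 hc)
    refine le_trans ?_ h
    exact le_iSup₂_of_le ω₀ h0 (le_iSup_of_le h1 (le_iSup₂_of_le R hR le_rfl))
  simp only [orbitDimAt, iInf_lt_iff] at hd
  obtain ⟨m, ε, hε, hlim⟩ := hd
  refine ⟨m, ε, hε, ?_⟩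
  filter_upwards [eventually_lt_of_limsup_lt hlim, eventually_gt_atTop 0] with k hk hk0
  refine (colorable_of_orbitCoveringNumber hk0 (fun a ha j => ha.1 j) h0).mono
    subset_rfl (fun a _ b _ => ?_) ?_
  · rintro ⟨W, hW, hab⟩
    exact ⟨W, hW, fun j => (hab j).trans_le (by rw [hω₀]; linarith [min_le_left ω 1])⟩
  · set N := orbitCoveringNumber (microstates τ y R m k ε) ω₀
    have hN : (0 : ℝ) < (max N 1 : ℕ) := by exact_mod_cast lt_of_lt_of_le one_pos (le_max_right _ _)
    have hk' : (0 : ℝ) < (k : ℝ) ^ 2 := by positivity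
    rw [EReal.coe_lt_coe_iff, div_lt_div_iff₀ (by nlinarith) (by linarith)] at hk
    have : Real.log ((max N 1 : ℕ) : ℝ) ≤ α * (k : ℝ) ^ 2 := by
      by_contra hlt
      push Not at hlt
      nlinarith [mul_lt_mul_of_pos_right hlt (neg_pos.2 hlog)]
    refine le_trans ?_ ((Real.log_le_iff_le_exp hN).1 this)
    exact_mod_cast le_max_left _ _

lemma upperOrbitDim_le_zero (h : NegligibleOrbits τ y) : upperOrbitDim τ y ≤ 0 := by
  refine iSup₂_le fun ω hω => iSup_le fun hω1 => iSup₂_le fun R hR => ?_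
  refine EReal.le_of_forall_lt_iff_le.1 fun c hc => ?_
  have hc : 0 < c := by exact_mod_cast hc
  have hlog : Real.log ω < 0 := Real.log_neg hω hω1
  obtain ⟨m, ε, hε, hk⟩ := h R hR (ω / (n + 1)) (by positivity) (c * -Real.log ω)
    (mul_pos hc (neg_pos.2 hlog))
  refine iInf_le_of_le m (iInf₂_le_of_le ε hε (limsup_le_of_le (h := ?_)))
  filter_upwards [hk, eventually_gt_atTop 0] with k hk hk0
  have hk' : (0 : ℝ) < (k : ℝ) ^ 2 := by positivity
  have h1 := hk.orbitCoveringNumber_le hk0 hω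
  have hN : ((max (orbitCoveringNumber (microstates τ y R m k ε) ω) 1 : ℕ) : ℝ)
      ≤ Real.exp (c * -Real.log ω * (k : ℝ) ^ 2) := by
    rw [Nat.cast_max]
    refine max_le h1 ?_
    rw [Nat.cast_one]
    exact Real.one_le_exp (by nlinarith [mul_pos (mul_pos hc (neg_pos.2 hlog)) hk'])
  rw [EReal.coe_le_coe_iff, div_le_iff₀ (by nlinarith)]
  have := (Real.log_le_iff_le_exp
    (by exact_mod_cast lt_of_lt_of_le one_pos (le_max_right _ _))).2 hN
  linarith

end Dimension

/-! ### Almost commutants of small projections -/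

/-- In a normed space of dimension `d`, the ball of radius `2` is covered by `(5 ^ d) ^ j` balls
of radius `2 / 2 ^ j`. -/
lemma exists_cover_ball_two {E : Type*} [NormedAddCommGroup E] [NormedSpace ℝ E]
    [FiniteDimensional ℝ E] (j : ℕ) :
    ∃ t : Finset E, t.card ≤ (5 ^ Module.finrank ℝ E) ^ j ∧
      ∀ v : E, ‖v‖ ≤ 2 → ∃ c ∈ t, ‖v - c‖ ≤ 2 * (1 / 2) ^ j := by
  classical
  -- a maximal `1`-separated subset of the ball of radius `2` is a cover by balls of radius `1`
  obtain ⟨t₁, ht₁, hc₁⟩ : ∃ t : Finset E, t.card ≤ 5 ^ Module.finrank ℝ E ∧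
      ∀ v : E, ‖v‖ ≤ 2 → ∃ c ∈ t, ‖v - c‖ ≤ 1 := by
    let good (t : Finset E) : Prop :=
      (∀ c ∈ t, ‖c‖ ≤ 2) ∧ ∀ c ∈ t, ∀ d ∈ t, c ≠ d → 1 ≤ ‖c - d‖
    have hcard (t : Finset E) (h : good t) : t.card ≤ 5 ^ Module.finrank ℝ E :=
      Besicovitch.card_le_of_separated t h.1 h.2
    have hex : ∃ N, ∃ t, good t ∧ t.card = N := ⟨0, ∅, by simp [good], rfl⟩
    have hbd (N) (h : ∃ t, good t ∧ t.card = N) : N ≤ 5 ^ Module.finrank ℝ E := by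
      obtain ⟨t, h, rfl⟩ := h; exact hcard t h
    obtain ⟨t, ht, hN⟩ := Nat.findGreatest_spec (P := fun N => ∃ t, good t ∧ t.card = N)
      (hbd _ hex.choose_spec) hex.choose_spec
    refine ⟨t, hcard t ht, fun v hv => ?_⟩
    by_contra! hcon
    have hvt : v ∉ t := fun h => by
      have := hcon v h
      simp only [sub_self, norm_zero] at this
      linarith
    have hg : good (insert v t) := by
      refine ⟨fun c hc => ?_, fun c hc d hd hcd => ?_⟩
      · rcases Finset.mem_insert.1 hc with rfl | hc
        exacts [hv, ht.1 c hc]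
      · rcases Finset.mem_insert.1 hc with rfl | hc' <;>
          rcases Finset.mem_insert.1 hd with rfl | hd'
        · exact absurd rfl hcd
        · exact (hcon d hd').le
        · rw [norm_sub_rev]; exact (hcon c hc').le
        · exact ht.2 c hc' d hd' hcd
    have := Nat.le_findGreatest (P := fun N => ∃ t, good t ∧ t.card = N) (hcard _ hg)
      ⟨_, hg, rfl⟩
    rw [Finset.card_insert_of_notMem hvt, hN] at this
    omega
  induction j with
  | zero => exact ⟨{0}, by simp, fun v hv => ⟨0, by simp, by simpa using hv⟩⟩
  | succ j ih =>
    obtain ⟨t, ht, hc⟩ := ih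
    refine ⟨(t ×ˢ t₁).image fun p => p.1 + ((1 / 2 : ℝ) ^ j) • p.2, ?_, fun v hv => ?_⟩
    · refine Finset.card_image_le.trans ?_
      rw [Finset.card_product, pow_succ]
      exact Nat.mul_le_mul ht ht₁
    · obtain ⟨c, hct, hcv⟩ := hc v hv
      have hpos : (0 : ℝ) < (1 / 2) ^ j := by positivity
      have hne : ((1 / 2 : ℝ) ^ j) ≠ 0 := hpos.ne'
      have h2 : ‖((1 / 2 : ℝ) ^ j)⁻¹ • (v - c)‖ ≤ 2 := by
        rw [norm_smul, norm_inv, Real.norm_of_nonneg hpos.le, inv_mul_le_iff₀ hpos, mul_comm]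
        exact hcv
      obtain ⟨d, hd, hdv⟩ := hc₁ _ h2
      refine ⟨_, Finset.mem_image_of_mem _ (Finset.mem_product.2 ⟨hct, hd⟩ : (c, d) ∈ _), ?_⟩
      have e : v - (c + ((1 / 2 : ℝ) ^ j) • d)
          = ((1 / 2 : ℝ) ^ j) • (((1 / 2 : ℝ) ^ j)⁻¹ • (v - c) - d) := by
        rw [smul_sub, smul_smul, mul_inv_cancel₀ hne, one_smul]; abel
      rw [e, norm_smul, Real.norm_of_nonneg hpos.le, pow_succ]
      nlinarith

lemma exists_cover_seminorm_ball_two {E : Type*} [AddCommGroup E] [Module ℝ E]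
    [FiniteDimensional ℝ E] (p : Seminorm ℝ E) (hp : ∀ x, p x = 0 → x = 0) (j : ℕ) :
    ∃ t : Finset E, t.card ≤ (5 ^ Module.finrank ℝ E) ^ j ∧
      ∀ v : E, p v ≤ 2 → ∃ c ∈ t, p (v - c) ≤ 2 * (1 / 2) ^ j := by
  let g : AddGroupNorm E := { p.toAddGroupSeminorm with eq_zero_of_map_eq_zero' := hp }
  let _ : NormedAddCommGroup E := g.toNormedAddCommGroup
  let _ : NormedSpace ℝ E := ⟨fun c x => (map_smul_eq_mul p c x).le⟩
  exact exists_cover_ball_two j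

section Matrices

variable {k : ℕ}

lemma twoNorm_matTrace_sq (hk : 0 < k) (A : Matrix (Fin k) (Fin k) ℂ) :
    (k : ℝ) * twoNorm (matTrace k) A ^ 2 = ∑ i, ∑ j, ‖A i j‖ ^ 2 := by
  have hk' : (k : ℝ) ≠ 0 := by exact_mod_cast hk.ne'
  rw [(isTrace_matTrace hk).twoNorm_sq, matTrace_apply, normTrace]
  have : (star A * A).trace = ((∑ i, ∑ j, ‖A i j‖ ^ 2 : ℝ) : ℂ) := by
    rw [Finset.sum_comm]
    simp only [Matrix.trace, Matrix.diag, Matrix.mul_apply, Matrix.star_apply]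
    push_cast
    exact Finset.sum_congr rfl fun i _ => Finset.sum_congr rfl fun j _ => Complex.conj_mul' _
  rw [this, ← Complex.ofReal_natCast, ← Complex.ofReal_div, Complex.ofReal_re]
  field_simp

lemma eq_zero_of_twoNorm_matTrace_eq_zero (hk : 0 < k) {A : Matrix (Fin k) (Fin k) ℂ}
    (h : twoNorm (matTrace k) A = 0) : A = 0 := by
  have := twoNorm_matTrace_sq hk A
  rw [h] at this
  simp only [ne_eq, OfNat.ofNat_ne_zero, not_false_eq_true, zero_pow, mul_zero] at this
  ext i j
  have h1 := (Finset.sum_eq_zero_iff_of_nonneg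
    (fun i _ => Finset.sum_nonneg fun j _ => sq_nonneg _)).1 this.symm i (Finset.mem_univ i)
  have h2 := (Finset.sum_eq_zero_iff_of_nonneg (fun j _ => sq_nonneg _)).1 h1 j (Finset.mem_univ j)
  simpa using h2

lemma twoNorm_matTrace_diagonal_sq (hk : 0 < k) (d : Fin k → ℂ) :
    (k : ℝ) * twoNorm (matTrace k) (Matrix.diagonal d) ^ 2 = ∑ i, ‖d i‖ ^ 2 := by
  rw [twoNorm_matTrace_sq hk]
  refine Finset.sum_congr rfl fun i _ => ?_
  rw [Finset.sum_eq_single i (fun j _ hj => by simp [Matrix.diagonal_apply_ne _ hj.symm])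
    (by simp)]
  simp

lemma twoNorm_conj {A : Type*} [CStarAlgebra A] {τ : A →ₗ[ℂ] ℂ} (hτ : IsTrace τ) {u : A}
    (hu : u ∈ unitary A) (a : A) : twoNorm τ (u * a * star u) = twoNorm τ a := by
  refine le_antisymm (hτ.twoNorm_conj_le hu a) ?_
  have h := hτ.twoNorm_conj_le (Unitary.star_mem hu) (u * a * star u)
  have h1 : star u * u = 1 := (Unitary.mem_iff.1 hu).1
  have e : star u * (u * a * star u) * star (star u) = a := by
    calc _ = (star u * u) * a * (star u * u) := by simp [mul_assoc]
      _ = a := by simp [h1]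
  rwa [e] at h

lemma diagonal_mul_mul_diagonal_indicator (s : Finset (Fin k)) (Y : Matrix (Fin k) (Fin k) ℂ) :
    Matrix.diagonal (fun i => if i ∈ s then 1 else 0) * Y *
      Matrix.diagonal (fun i => if i ∈ s then 1 else 0)
      = ∑ x : s, ∑ y : s, Y x y • Matrix.single (x : Fin k) (y : Fin k) 1 := by
  have e : ∑ x : s, ∑ y : s, Y x y • Matrix.single (x : Fin k) (y : Fin k) (1 : ℂ)
      = ∑ x ∈ s, ∑ y ∈ s, Y x y • Matrix.single x y (1 : ℂ) := by
    rw [← Finset.sum_coe_sort s]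
    exact Finset.sum_congr rfl fun x _ =>
      Finset.sum_coe_sort s (fun y => Y x y • Matrix.single (x : Fin k) y (1 : ℂ))
  rw [e]
  ext i j
  simp only [Matrix.sum_apply, Matrix.smul_apply, Matrix.single_apply, Matrix.mul_diagonal,
    Matrix.diagonal_mul, ite_and, smul_eq_mul, mul_ite, mul_one, mul_zero, ite_mul, one_mul,
    zero_mul, Finset.sum_ite_irrel, Finset.sum_const_zero, Finset.sum_ite_eq']
  split_ifs <;> rfl

/-- The spectral projection of `F` onto the eigenvalues larger than `1/2`, whose range is spanned
by the columns of `U` with index in `s`. -/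
lemma exists_spectral_cut (hk : 0 < k) {F : Matrix (Fin k) (Fin k) ℂ} (hF : F.IsHermitian) :
    ∃ U ∈ Matrix.unitaryGroup (Fin k) ℂ, ∃ s : Finset (Fin k),
      twoNorm (matTrace k) (F - U * Matrix.diagonal (fun i => if i ∈ s then 1 else 0) * Uᴴ)
        ≤ 2 * twoNorm (matTrace k) (F * F - F) ∧
      (s.card : ℝ) ≤ 4 * k * twoNorm (matTrace k) F ^ 2 := by
  have hτ := isTrace_matTrace hk
  set U : Matrix (Fin k) (Fin k) ℂ := (hF.eigenvectorUnitary : Matrix (Fin k) (Fin k) ℂ)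
  have hU : U ∈ Matrix.unitaryGroup (Fin k) ℂ := hF.eigenvectorUnitary.2
  set l := hF.eigenvalues
  have hFU : F = U * Matrix.diagonal (fun i => (l i : ℂ)) * star U := by
    have := hF.spectral_theorem
    rw [Unitary.conjStarAlgAut_apply] at this
    exact this
  have hUU : star U * U = 1 := (Unitary.mem_iff.1 hU).1
  set s : Finset (Fin k) := Finset.univ.filter fun i => 1 / 2 < l i
  have hkR : (0 : ℝ) < k := by exact_mod_cast hk
  refine ⟨U, hU, s, ?_, ?_⟩
  · have e1 : F - U * Matrix.diagonal (fun i => if i ∈ s then 1 else 0) * Uᴴ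
        = U * Matrix.diagonal (fun i => (l i : ℂ) - if i ∈ s then 1 else 0) * star U := by
      rw [← Matrix.diagonal_sub, mul_sub, sub_mul, ← hFU]; rfl
    have e2 : F * F - F = U * Matrix.diagonal (fun i => (l i : ℂ) * l i - l i) * star U := by
      rw [← Matrix.diagonal_sub, ← Matrix.diagonal_mul_diagonal, mul_sub, sub_mul, ← hFU]
      congr 1
      conv_lhs => rw [hFU]
      calc _ = U * Matrix.diagonal (fun i => (l i : ℂ)) * (star U * U) *
            Matrix.diagonal (fun i => (l i : ℂ)) * star U := by simp only [mul_assoc]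
        _ = _ := by rw [hUU, mul_one]; simp only [mul_assoc]
    rw [e1, e2, twoNorm_conj hτ hU, twoNorm_conj hτ hU]
    refine le_of_sq_le_sq ?_ (mul_nonneg zero_le_two (twoNorm_nonneg _))
    rw [mul_pow, ← mul_le_mul_iff_right₀ hkR, mul_left_comm, twoNorm_matTrace_diagonal_sq hk,
      twoNorm_matTrace_diagonal_sq hk, Finset.mul_sum]
    refine Finset.sum_le_sum fun i _ => ?_
    rw [← mul_pow]
    refine pow_le_pow_left₀ (norm_nonneg _) ?_ 2
    have : (l i : ℂ) * l i - l i = ((l i * l i - l i : ℝ) : ℂ) := by push_cast; ring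
    rw [this, Complex.norm_real, Real.norm_eq_abs]
    split_ifs with h
    · have h : 1 / 2 < l i := (Finset.mem_filter.1 h).2
      rw [show (l i : ℂ) - 1 = ((l i - 1 : ℝ) : ℂ) by push_cast; ring, Complex.norm_real,
        Real.norm_eq_abs, show l i * l i - l i = l i * (l i - 1) by ring, abs_mul,
        abs_of_pos (by linarith : 0 < l i)]
      nlinarith [abs_nonneg (l i - 1)]
    · have h : l i ≤ 1 / 2 := by
        by_contra h'
        exact h (Finset.mem_filter.2 ⟨Finset.mem_univ _, not_le.1 h'⟩)
      rw [sub_zero, Complex.norm_real, Real.norm_eq_abs,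
        show l i * l i - l i = l i * (l i - 1) by ring, abs_mul,
        abs_of_nonpos (by linarith : l i - 1 ≤ 0)]
      nlinarith [abs_nonneg (l i)]
  · conv_rhs => rw [hFU, twoNorm_conj hτ hU, mul_assoc, twoNorm_matTrace_diagonal_sq hk]
    rw [Finset.mul_sum, Finset.card_eq_sum_ones]
    push_cast
    refine (Finset.sum_le_sum (fun i hi => ?_)).trans
      (Finset.sum_le_sum_of_subset_of_nonneg (Finset.subset_univ s)
        fun i _ _ => mul_nonneg (by norm_num) (sq_nonneg _))
    have h : 1 / 2 < l i := (Finset.mem_filter.1 hi).2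
    rw [Complex.norm_real, Real.norm_eq_abs, sq_abs]
    nlinarith

/-- A unitary almost commuting with `F` is, up to a small `2`-norm error, preserved by compression
to a projection `p` close to `F`, after summation over a partition of unity. -/
lemma IsTrace.twoNorm_sub_sum_compress_le {A : Type*} [CStarAlgebra A] {τ : A →ₗ[ℂ] ℂ}
    (hτ : IsTrace τ) {r : ℕ} {F p : Fin r → A} {T : A} (hT : ‖T‖ ≤ 1) {η : ℝ}
    (hp : ∀ l, p l * p l = p l) (hp1 : ∀ l, ‖p l‖ ≤ 1)
    (hFp : ∀ l, twoNorm τ (F l - p l) ≤ 2 * η) (h1 : twoNorm τ (1 - ∑ l, F l) ≤ η)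
    (hTF : ∀ l, twoNorm τ (T * F l - F l * T) ≤ η) :
    twoNorm τ (T - ∑ l, p l * T * p l) ≤ (7 * r + 1) * η := by
  have e : T - ∑ l, p l * T * p l = (1 - ∑ l, F l) * T + (∑ l, (F l - p l) * T
      + ∑ l, p l * (p l * T - T * p l)) := by
    have (l : Fin r) : p l * (p l * T - T * p l) = p l * T - p l * T * p l := by
      rw [mul_sub, ← mul_assoc, hp, ← mul_assoc]
    simp only [this, sub_mul, one_mul, Finset.sum_sub_distrib, Finset.sum_mul]
    abel
  have mulT (a : A) : twoNorm τ (a * T) ≤ twoNorm τ a :=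
    (hτ.twoNorm_mul_le' _ _).trans (mul_le_of_le_one_right (twoNorm_nonneg _) hT)
  have Tmul (a : A) : twoNorm τ (T * a) ≤ twoNorm τ a :=
    (hτ.twoNorm_mul_le _ _).trans (mul_le_of_le_one_left (twoNorm_nonneg _) hT)
  have hcomm (l : Fin r) : twoNorm τ (p l * T - T * p l) ≤ 5 * η := by
    have e : p l * T - T * p l = (p l - F l) * T + (F l * T - T * F l + T * (F l - p l)) := by
      simp only [sub_mul, mul_sub]; abel
    rw [e]
    have a1 := (mulT (p l - F l)).trans ((twoNorm_sub_comm _ _).trans_le (hFp l))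
    have a2 := (twoNorm_sub_comm (τ := τ) (F l * T) _).trans_le (hTF l)
    have a3 := (Tmul (F l - p l)).trans (hFp l)
    linarith [hτ.twoNorm_add_le ((p l - F l) * T) (F l * T - T * F l + T * (F l - p l)),
      hτ.twoNorm_add_le (F l * T - T * F l) (T * (F l - p l))]
  have b1 := (mulT (1 - ∑ l, F l)).trans h1
  have b2 : twoNorm τ (∑ l, (F l - p l) * T) ≤ r * (2 * η) :=
    (hτ.twoNorm_sum_le _ _).trans ((Finset.sum_le_sum fun l _ => (mulT _).trans (hFp l)).trans
      (by simp))
  have b3 : twoNorm τ (∑ l, p l * (p l * T - T * p l)) ≤ r * (5 * η) := by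
    refine (hτ.twoNorm_sum_le _ _).trans ((Finset.sum_le_sum fun l _ =>
      (hτ.twoNorm_mul_le _ _).trans ?_).trans (by simp : ∑ _l : Fin r, 5 * η ≤ r * (5 * η)))
    calc _ ≤ 1 * (5 * η) := mul_le_mul (hp1 l) (hcomm l) (twoNorm_nonneg _) zero_le_one
      _ = _ := one_mul _
  rw [e]
  linarith [hτ.twoNorm_add_le ((1 - ∑ l, F l) * T) (∑ l, (F l - p l) * T
      + ∑ l, p l * (p l * T - T * p l)), hτ.twoNorm_add_le (∑ l, (F l - p l) * T)
      (∑ l, p l * (p l * T - T * p l))]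

/-- The `2`-norm on matrices as a real seminorm. -/
def matTwoSeminorm (hk : 0 < k) : Seminorm ℝ (Matrix (Fin k) (Fin k) ℂ) :=
  .of (twoNorm (matTrace k)) (isTrace_matTrace hk).twoNorm_add_le fun c a => by
    rw [← Complex.coe_smul, twoNorm_smul, Complex.norm_real]

/-- Unitary matrices that almost commute with matrices `F l` which nearly form a partition of
unity into projections of small trace lie near the space of block matrices `∑ p_l T p_l`, whose
dimension is a small multiple of `k²`; hence they have a coloring with few colors. -/
theorem exists_colorable_almost_commutant {θ : ℝ} (hθ : 0 < θ) :
    ∃ κ > 0, ∀ r : ℕ, ∃ η₀ > 0, ∀ η ≤ η₀, 0 ≤ η → ∀ (k : ℕ), 0 < k →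
      ∀ (F : Fin r → Matrix (Fin k) (Fin k) ℂ) (β : ℝ), (∀ l, (F l).IsHermitian) →
      (∀ l, twoNorm (matTrace k) (F l * F l - F l) ≤ η) →
      twoNorm (matTrace k) (1 - ∑ l, F l) ≤ η →
      ∑ l, twoNorm (matTrace k) (F l) ^ 4 ≤ β →
      Colorable {T | T ∈ Matrix.unitaryGroup (Fin k) ℂ ∧
          ∀ l, twoNorm (matTrace k) (T * F l - F l * T) ≤ η}
        (fun T T' => twoNorm (matTrace k) (T - T') < θ) (Real.exp (κ * β * (k : ℝ) ^ 2)) := by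
  obtain ⟨j, hj⟩ := exists_pow_lt_of_lt_one (by positivity : 0 < θ / 16)
    (by norm_num : (1 / 2 : ℝ) < 1)
  refine ⟨32 * (j + 1) * Real.log 5, by positivity, fun r => ?_⟩
  set θ' := min θ 1
  have hθ' : 0 < θ' := lt_min hθ one_pos
  refine ⟨θ' / 8 / (7 * r + 1), by positivity, fun η hη hη0 k hk F β hF hFF hF1 hβ => ?_⟩
  have hτ := isTrace_matTrace hk
  choose U hU s hUs hs using fun l => exists_spectral_cut hk (hF l)
  set D : Fin r → Matrix (Fin k) (Fin k) ℂ :=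
    fun l => Matrix.diagonal (fun i => if i ∈ s l then 1 else 0) with hD
  set p : Fin r → Matrix (Fin k) (Fin k) ℂ := fun l => U l * D l * (U l)ᴴ with hp
  -- the space of block matrices
  let b : (Σ l : Fin r, s l × s l) → Matrix (Fin k) (Fin k) ℂ :=
    fun q => U q.1 * Matrix.single (q.2.1 : Fin k) (q.2.2 : Fin k) 1 * (U q.1)ᴴ
  set L : Submodule ℂ (Matrix (Fin k) (Fin k) ℂ) := Submodule.span ℂ (Set.range b)
  have hUU (l) : (U l)ᴴ * U l = 1 := (Unitary.mem_iff.1 (hU l)).1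
  have hmem (T) : ∑ l, p l * T * p l ∈ L := by
    refine Submodule.sum_mem _ fun l _ => ?_
    have e : p l * T * p l = ∑ x : s l, ∑ y : s l, (((U l)ᴴ * T * U l) x y) • b ⟨l, x, y⟩ := by
      have e1 : p l * T * p l = U l * (D l * ((U l)ᴴ * T * U l) * D l) * (U l)ᴴ := by
        simp only [hp, mul_assoc]
      have e2 := diagonal_mul_mul_diagonal_indicator (s l) ((U l)ᴴ * T * U l)
      rw [e1, e2]
      simp only [b, Finset.mul_sum, Finset.sum_mul, Matrix.mul_smul, Matrix.smul_mul]
    rw [e]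
    exact Submodule.sum_mem _ fun x _ => Submodule.sum_mem _ fun y _ =>
      Submodule.smul_mem _ _ (Submodule.subset_span ⟨_, rfl⟩)
  have hdim : (Module.finrank ℝ L : ℝ) ≤ 32 * β * (k : ℝ) ^ 2 := by
    have h1 : Module.finrank ℝ L = 2 * Module.finrank ℂ L := finrank_real_of_complex L
    have h2 : Module.finrank ℂ L ≤ ∑ l, (s l).card * (s l).card := by
      refine (finrank_range_le_card b).trans (le_of_eq ?_)
      simp
    have h2' : (Module.finrank ℂ L : ℝ) ≤ ∑ l, ((s l).card : ℝ) * (s l).card := by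
      exact_mod_cast h2
    have h3 : ∑ l, ((s l).card : ℝ) * (s l).card
        ≤ ∑ l, 16 * (k : ℝ) ^ 2 * twoNorm (matTrace k) (F l) ^ 4 := by
      refine Finset.sum_le_sum fun l _ => ?_
      have := mul_le_mul (hs l) (hs l) (by positivity) (by positivity)
      linarith
    rw [← Finset.mul_sum] at h3
    have h4 := mul_le_mul_of_nonneg_left hβ (by positivity : 0 ≤ 16 * (k : ℝ) ^ 2)
    rw [h1]; push_cast
    linarith
  have : FiniteDimensional ℝ L := FiniteDimensional.complexToReal L
  obtain ⟨t, ht, hcov⟩ := exists_cover_seminorm_ball_two (E := L)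
    ((matTwoSeminorm hk).comp (L.subtype.restrictScalars ℝ))
    (fun x hx => Subtype.ext (eq_zero_of_twoNorm_matTrace_eq_zero hk hx)) (j + 1)
  have hcov' (v : Matrix (Fin k) (Fin k) ℂ) (hv : v ∈ L) (h2 : twoNorm (matTrace k) v ≤ 2) :
      ∃ c ∈ t, twoNorm (matTrace k) (v - c) ≤ 2 * (1 / 2) ^ (j + 1) := hcov ⟨v, hv⟩ h2
  have happrox (T) (hT : T ∈ {T | T ∈ Matrix.unitaryGroup (Fin k) ℂ ∧
          ∀ l, twoNorm (matTrace k) (T * F l - F l * T) ≤ η}) :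
      ∃ c ∈ t, twoNorm (matTrace k) (T - c) ≤ θ / 4 := by
    have hT1 : ‖T‖ ≤ 1 := norm_le_one_of_mem_unitary hT.1
    have hDD (l) : D l * D l = D l := by
      simp only [hD, Matrix.diagonal_mul_diagonal]
      congr 1; ext i; split_ifs <;> simp
    have hpp (l) : p l * p l = p l := by
      calc p l * p l = U l * D l * ((U l)ᴴ * U l) * D l * (U l)ᴴ := by simp only [hp, mul_assoc]
        _ = U l * (D l * D l) * (U l)ᴴ := by rw [hUU]; simp only [mul_assoc, one_mul]
        _ = p l := by rw [hDD]
    have hps (l) : (p l)ᴴ = p l := by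
      simp only [hp, Matrix.conjTranspose_mul, Matrix.conjTranspose_conjTranspose, hD,
        Matrix.diagonal_conjTranspose, mul_assoc]
      congr 3; ext i; simp only [Pi.star_apply]; split_ifs <;> simp
    have hp1 (l) : ‖p l‖ ≤ 1 := by
      have h : ‖p l‖ * ‖p l‖ = ‖p l‖ := by
        rw [← CStarRing.norm_star_mul_self, Matrix.star_eq_conjTranspose, hps, hpp]
      nlinarith [norm_nonneg (p l)]
    have h := hτ.twoNorm_sub_sum_compress_le hT1 hpp hp1
      (fun l => (hUs l).trans (by linarith [hFF l])) hF1 hT.2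
    have hη' : (7 * r + 1) * η ≤ θ' / 8 := by
      rw [mul_comm]; exact (le_div_iff₀ (by positivity)).1 hη
    have h2 : twoNorm (matTrace k) (∑ l, p l * T * p l) ≤ 2 := by
      have e := hτ.twoNorm_sub_le (∑ l, p l * T * p l) T 0
      rw [sub_zero, sub_zero, twoNorm_sub_comm] at e
      linarith [min_le_right θ 1, hτ.twoNorm_le_norm T]
    obtain ⟨c, hc, hcT⟩ := hcov' _ (hmem T) h2
    refine ⟨c, hc, (hτ.twoNorm_sub_le _ (∑ l, p l * T * p l) _).trans ?_⟩
    rw [pow_succ] at hcT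
    linarith [min_le_left θ 1]
  choose! c hct hc using happrox
  refine .of_finset c t hct ?_ fun T hT T' hT' e => ?_
  · have : (t.card : ℝ) ≤ (5 ^ Module.finrank ℝ L) ^ (j + 1) := by exact_mod_cast ht
    refine this.trans ?_
    rw [← pow_mul, ← Real.rpow_natCast, Real.rpow_def_of_pos (by norm_num), Real.exp_le_exp]
    push_cast
    have hl : 0 < Real.log 5 := Real.log_pos (by norm_num)
    have := mul_le_mul_of_nonneg_left hdim (by positivity : 0 ≤ Real.log 5 * ((j : ℝ) + 1))
    linarith
  · have h1 := hc T hT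
    have h2 := hc T' hT'
    rw [← e, twoNorm_sub_comm] at h2
    linarith [hτ.twoNorm_sub_le T (c T) T']

end Matrices

/-! ### Amalgamation over approximate partitions of unity -/

variable {A : Type*} [CStarAlgebra A] {τ : A →ₗ[ℂ] ℂ}

/-- The element `a` is a `2`-norm limit of `*`-polynomials in `y` that stay bounded in operator
norm, by a constant `C` independent of the precision and of the cutoff `R`, not only at `y` but at
all matrix tuples bounded by `R`. -/
def BoundedApprox (τ : A →ₗ[ℂ] ℂ) {n : ℕ} (y : Fin n → A) (a : A) : Prop :=
  ∃ C : ℝ, ∀ R : ℝ, (∀ j, ‖y j‖ ≤ R) → ∀ δ > 0, ∃ P : StarPoly (Fin n),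
    ‖P.eval y‖ ≤ C ∧ twoNorm τ (a - P.eval y) ≤ δ ∧
    ∀ k : ℕ, 0 < k → ∀ b : Fin n → Matrix (Fin k) (Fin k) ℂ, (∀ i, ‖b i‖ ≤ R) → ‖P.eval b‖ ≤ C

lemma norm_half_add_star_le {B : Type*} [CStarAlgebra B] (a : B) :
    ‖(2⁻¹ : ℂ) • (a + star a)‖ ≤ ‖a‖ := by
  rw [norm_smul, norm_inv, Complex.norm_ofNat]
  linarith [norm_add_le a (star a), norm_star a]

/-- Passing to real parts improves the approximation of self-adjoint elements. -/
lemma IsTrace.twoNorm_sub_eval_realPart_le (hτ : IsTrace τ) {g : A} (hg : IsSelfAdjoint g)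
    {ι : Type} (x : ι → A) (P : StarPoly ι) :
    twoNorm τ (g - P.realPart.eval x) ≤ twoNorm τ (g - P.eval x) := by
  have h1 : g - P.realPart.eval x = (2⁻¹ : ℂ) • ((g - P.eval x) + star (g - P.eval x)) := by
    rw [StarPoly.eval_realPart, star_sub, hg.star_eq]
    have : g - P.eval x + (g - star (P.eval x))
        = (2 : ℂ) • g - (P.eval x + star (P.eval x)) := by
      rw [two_smul]; abel
    rw [this, smul_sub, smul_smul]; simp
  rw [h1, twoNorm_smul, norm_inv, Complex.norm_ofNat]
  have := hτ.twoNorm_add_le (g - P.eval x) (star (g - P.eval x))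
  rw [hτ.twoNorm_star] at this
  linarith

/-- Near a projection `e`, the defect of idempotency is controlled in `2`-norm. -/
lemma IsTrace.twoNorm_mul_self_sub_self_le (hτ : IsTrace τ) {e f : A} (he : IsStarProjection e)
    {C δ : ℝ} (hf : ‖f‖ ≤ C) (h : twoNorm τ (e - f) ≤ δ) :
    twoNorm τ (f * f - f) ≤ (C + 2) * δ := by
  have hee : e * e = e := he.isIdempotentElem
  have he1 : ‖e‖ ≤ 1 := he.norm_le e
  have h0 := twoNorm_nonneg (τ := τ) (e - f)
  have h1 := hτ.twoNorm_mul_sub_mul_le f f e e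
  have h2 := hτ.twoNorm_sub_le (f * f) e f
  rw [hee, twoNorm_sub_comm f e] at h1
  have h3 : ‖f‖ * twoNorm τ (e - f) ≤ C * δ := mul_le_mul hf h h0 ((norm_nonneg f).trans hf)
  have h4 : ‖e‖ * twoNorm τ (e - f) ≤ 1 * δ := mul_le_mul he1 h h0 zero_le_one
  linarith

/-- Projections approximated by `*`-polynomials in `x` are approximated by `*`-polynomials with
self-adjoint values that are almost idempotent at `x`. -/
lemma exists_selfAdjoint_approx (hτ : IsTrace τ) {p : ℕ} {x : Fin p → A} {r : ℕ} {e : Fin r → A}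
    (he : ∀ l, IsStarProjection (e l)) (hx : ∀ l, BoundedApprox τ x (e l)) :
    ∀ δ > 0, ∃ f : Fin r → StarPoly (Fin p),
      (∀ (l) (k : ℕ) (b : Fin p → Matrix (Fin k) (Fin k) ℂ), ((f l).eval b).IsHermitian) ∧
      (∀ l, twoNorm τ (e l - (f l).eval x) ≤ δ) ∧
      (∀ l, twoNorm τ ((f l).eval x * (f l).eval x - (f l).eval x) ≤ δ) := by
  intro δ hδ
  choose C hC using hx
  choose P hP using fun l => hC l (∑ j, ‖x j‖)
    (fun j => Finset.single_le_sum (fun j _ => norm_nonneg (x j)) (Finset.mem_univ j))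
    (min δ (δ / (|C l| + 2))) (lt_min hδ (by positivity))
  have hclose (l) : twoNorm τ (e l - (P l).realPart.eval x) ≤ min δ (δ / (|C l| + 2)) :=
    (hτ.twoNorm_sub_eval_realPart_le (he l).isSelfAdjoint x (P l)).trans (hP l).2.1
  refine ⟨fun l => (P l).realPart, fun l k b => StarPoly.isSelfAdjoint_eval_realPart b _,
    fun l => (hclose l).trans (min_le_left _ _), fun l => ?_⟩
  have hn : ‖(P l).realPart.eval x‖ ≤ |C l| := by
    rw [StarPoly.eval_realPart]
    exact (norm_half_add_star_le _).trans ((hP l).1.trans (le_abs_self _))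
  refine (hτ.twoNorm_mul_self_sub_self_le (he l) hn ((hclose l).trans (min_le_right _ _))).trans ?_
  rw [mul_div_cancel₀]; positivity

/-- A `*`-polynomial in the first tuple of variables. -/
abbrev StarPoly.inl {p q : ℕ} (f : StarPoly (Fin p)) : StarPoly (Fin p ⊕ Fin q) :=
  f.subst fun i => .var (Sum.inl i)

/-- A `*`-polynomial in the second tuple of variables. -/
abbrev StarPoly.inr {p q : ℕ} (f : StarPoly (Fin q)) : StarPoly (Fin p ⊕ Fin q) :=
  f.subst fun i => .var (Sum.inr i)

section Matrices

variable {k n p q : ℕ}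

/-- Conjugates of the same tuple by `T` and `T'` are close when `T` and `T'` are. -/
lemma IsTrace.twoNorm_conj_sub_conj_le (hτ : IsTrace τ) {T T' a : A} {C θ : ℝ}
    (hT : T ∈ unitary A) (hT' : T' ∈ unitary A) (ha : ‖a‖ ≤ C) (h : twoNorm τ (T - T') ≤ θ) :
    twoNorm τ (T * a * star T - T' * a * star T') ≤ 2 * C * θ := by
  have hC : 0 ≤ C := (norm_nonneg a).trans ha
  have n1 : ‖star T‖ ≤ 1 := norm_le_one_of_mem_unitary (Unitary.star_mem hT)
  have n2 : ‖T'‖ ≤ 1 := norm_le_one_of_mem_unitary hT'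
  have n3 : ‖T' * a‖ ≤ C := (norm_mul_le _ _).trans
    ((mul_le_mul n2 ha (norm_nonneg _) zero_le_one).trans (one_mul C).le)
  have h0 := twoNorm_nonneg (τ := τ) (T - T')
  have h1 := hτ.twoNorm_mul_sub_mul_le (T * a) (star T) (T' * a) (star T')
  rw [← sub_mul, ← star_sub, hτ.twoNorm_star] at h1
  have h2 := (hτ.twoNorm_mul_le' (T - T') a).trans (mul_le_mul h ha (norm_nonneg _) (h0.trans h))
  have h3 := mul_le_mul n1 h2 (twoNorm_nonneg _) zero_le_one
  have h4 := mul_le_mul n3 h h0 hC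
  linarith

/-- Values of a `*`-polynomial at orbit-close families. -/
lemma twoNorm_eval_sub_conj_le (hk : 0 < k) {C δ : ℝ} (hC : 0 ≤ C) {ι : Type}
    {a b : ι → Matrix (Fin k) (Fin k) ℂ} {U : Matrix (Fin k) (Fin k) ℂ}
    (hU : U ∈ Matrix.unitaryGroup (Fin k) ℂ) (ha : ∀ i, ‖a i‖ ≤ C) (hb : ∀ i, ‖b i‖ ≤ C)
    (hab : ∀ i, twoNorm (matTrace k) (a i - U * b i * Uᴴ) ≤ δ) (S : StarPoly ι) :
    twoNorm (matTrace k) (S.eval a - U * S.eval b * Uᴴ) ≤ S.lip C * δ := by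
  have := nontrivial_matrix hk
  have e : U * S.eval b * Uᴴ = S.eval fun i => U * b i * Uᴴ := (StarPoly.eval_conj hU b S).symm
  rw [e]
  refine StarPoly.twoNorm_eval_sub_le (isTrace_matTrace hk) hC ha (fun i => ?_) hab S
  exact norm_conj_le hU (hb i)

/-- The unitaries relating the two tuples in a family of nearby orbits almost commute with
`F`, if `F` is close to values of polynomials in both tuples. -/
lemma twoNorm_commutator_le (hk : 0 < k) {η : ℝ} {U V F G F₀ G₀ : Matrix (Fin k) (Fin k) ℂ}
    (hU : U ∈ Matrix.unitaryGroup (Fin k) ℂ) (hV : V ∈ Matrix.unitaryGroup (Fin k) ℂ)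
    (h1 : twoNorm (matTrace k) (F - G) ≤ η) (h2 : twoNorm (matTrace k) (F₀ - G₀) ≤ η)
    (h3 : twoNorm (matTrace k) (F - U * F₀ * Uᴴ) ≤ η)
    (h4 : twoNorm (matTrace k) (G - V * G₀ * Vᴴ) ≤ η) :
    twoNorm (matTrace k) (Uᴴ * V * F₀ - F₀ * (Uᴴ * V)) ≤ 4 * η := by
  have hτ := isTrace_matTrace hk
  have hUU : Uᴴ * U = 1 := (Unitary.mem_iff.1 hU).1
  have hVV : Vᴴ * V = 1 := (Unitary.mem_iff.1 hV).1
  have e : Uᴴ * V * F₀ - F₀ * (Uᴴ * V) = Uᴴ * (V * F₀ * Vᴴ - U * F₀ * Uᴴ) * V := by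
    simp only [mul_sub, sub_mul, mul_assoc, hVV, mul_one]
    rw [← mul_assoc Uᴴ U, hUU, one_mul]
  have n1 : ‖Uᴴ‖ ≤ 1 := norm_le_one_of_mem_unitary (Unitary.star_mem hU)
  have n2 : ‖V‖ ≤ 1 := norm_le_one_of_mem_unitary hV
  have e2 : twoNorm (matTrace k) (V * F₀ * Vᴴ - V * G₀ * Vᴴ) ≤ η := by
    rw [← sub_mul, ← mul_sub]; exact (hτ.twoNorm_conj_le hV _).trans h2
  rw [e]
  refine (hτ.twoNorm_mul_le' _ _).trans ((mul_le_of_le_one_right (twoNorm_nonneg _) n2).trans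
    ((hτ.twoNorm_mul_le _ _).trans ((mul_le_of_le_one_left (twoNorm_nonneg _) n1).trans ?_)))
  rw [twoNorm_sub_comm] at h4 h1
  linarith [hτ.twoNorm_sub_le (V * F₀ * Vᴴ) (V * G₀ * Vᴴ) (U * F₀ * Uᴴ),
    hτ.twoNorm_sub_le (V * G₀ * Vᴴ) G (U * F₀ * Uᴴ), hτ.twoNorm_sub_le G F (U * F₀ * Uᴴ)]

end Matrices

/-- Colorings of the two marginal tuples `X a`, `Z a` up to unitary conjugation combine to a
coloring of the tuples `a`, which are nearly `*`-polynomials in `X a` and `Z a`. The relative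
position of the conjugating unitaries almost commutes with elements `f_l(X a) ≈ g_l(Z a)`,
so that a coloring of their almost commutant is all that is needed in addition. -/
lemma colorable_of_almost_commutant {n p q k r : ℕ} (hk : 0 < k)
    {s : Set (Fin n → Matrix (Fin k) (Fin k) ℂ)}
    (X : (Fin n → Matrix (Fin k) (Fin k) ℂ) → Fin p → Matrix (Fin k) (Fin k) ℂ)
    (Z : (Fin n → Matrix (Fin k) (Fin k) ℂ) → Fin q → Matrix (Fin k) (Fin k) ℂ)
    {C ω ω' η θ : ℝ} (hC : 0 ≤ C) (hω : 0 < ω)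
    (hX : ∀ a ∈ s, ∀ j, ‖X a j‖ ≤ C) (hZ : ∀ a ∈ s, ∀ j, ‖Z a j‖ ≤ C)
    (Q : Fin n → StarPoly (Fin p ⊕ Fin q))
    (hQ : ∀ a ∈ s, ∀ j,
      twoNorm (matTrace k) (a j - (Q j).eval (Sum.elim (X a) (Z a))) ≤ ω / 10)
    (hQω : ∀ j, (Q j).lip C * ω' ≤ ω / 20) (hQθ : ∀ j, (Q j).lip C * (2 * C * θ) ≤ ω / 20)
    (hθ : 0 ≤ θ)
    (f : Fin r → StarPoly (Fin p)) (g : Fin r → StarPoly (Fin q))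
    (hfg : ∀ a ∈ s, ∀ l,
      twoNorm (matTrace k) ((f l).eval (X a) - (g l).eval (Z a)) ≤ η / 4)
    (hfω : ∀ l, (f l).lip C * ω' ≤ η / 4) (hgω : ∀ l, (g l).lip C * ω' ≤ η / 4)
    {B₁ B₂ B₃ : ℝ} (hB₂ : 0 ≤ B₂) (hB₃ : 0 ≤ B₃)
    (h₁ : Colorable s (fun a b => OrbitClose ω' (X a) (X b)) B₁)
    (h₂ : Colorable s (fun a b => OrbitClose ω' (Z a) (Z b)) B₂)
    (h₃ : ∀ a ∈ s, Colorable {T | T ∈ Matrix.unitaryGroup (Fin k) ℂ ∧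
        ∀ l, twoNorm (matTrace k) (T * (f l).eval (X a) - (f l).eval (X a) * T) ≤ η}
      (fun T T' => twoNorm (matTrace k) (T - T') < θ) B₃) :
    Colorable s (OrbitClose ω) (B₁ * (B₂ * B₃)) := by
  have hτ := isTrace_matTrace hk
  have := nontrivial_matrix hk
  refine h₁.fiberwise (mul_nonneg hB₂ hB₃) fun s₁ hs₁ hX₁ => ?_
  refine (h₂.mono hs₁ (fun _ _ _ _ h => h) le_rfl).fiberwise hB₃ fun s₂ hs₂ hZ₂ => ?_
  rcases s₂.eq_empty_or_nonempty with rfl | ⟨a₀, ha₀⟩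
  · exact ⟨fun _ => 0, ∅, by simp, by simpa using hB₃, by simp⟩
  have hs (a) (ha : a ∈ s₂) : a ∈ s := hs₁ (hs₂ ha)
  have hU' (a) (ha : a ∈ s₂) : OrbitClose ω' (X a) (X a₀) :=
    hX₁ a (hs₂ ha) a₀ (hs₂ ha₀)
  have hV' (a) (ha : a ∈ s₂) : OrbitClose ω' (Z a) (Z a₀) := hZ₂ a ha a₀ ha₀
  choose! U hU hUX using hU'
  choose! V hV hVZ using hV'
  set T := fun a => (U a)ᴴ * V a with hT
  have hTu (a) (ha : a ∈ s₂) : T a ∈ Matrix.unitaryGroup (Fin k) ℂ :=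
    mul_mem (Unitary.star_mem (hU a ha)) (hV a ha)
  have hTmem (a) (ha : a ∈ s₂) : T a ∈ {T | T ∈ Matrix.unitaryGroup (Fin k) ℂ ∧
        ∀ l, twoNorm (matTrace k) (T * (f l).eval (X a₀) - (f l).eval (X a₀) * T) ≤ η} := by
    refine ⟨hTu a ha, fun l => ?_⟩
    have h := twoNorm_commutator_le hk (hU a ha) (hV a ha) (hfg a (hs a ha) l)
      (hfg a₀ (hs a₀ ha₀) l)
      ((twoNorm_eval_sub_conj_le hk hC (hU a ha) (hX a (hs a ha)) (hX a₀ (hs a₀ ha₀))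
        (fun i => (hUX a ha i).le) (f l)).trans (hfω l))
      ((twoNorm_eval_sub_conj_le hk hC (hV a ha) (hZ a (hs a ha)) (hZ a₀ (hs a₀ ha₀))
        (fun i => (hVZ a ha i).le) (g l)).trans (hgω l))
    linarith
  refine ((h₃ a₀ (hs a₀ ha₀)).comap T hTmem).mono subset_rfl (fun a ha b hb hab => ?_) le_rfl
  -- every tuple is close to a conjugate of a polynomial in `X a₀` and `T Z a₀ T*`
  let E (a) : Fin p ⊕ Fin q → Matrix (Fin k) (Fin k) ℂ :=
    Sum.elim (X a₀) fun i => T a * Z a₀ i * (T a)ᴴ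
  have hE (a) (ha : a ∈ s₂) (i) : ‖E a i‖ ≤ C := by
    rcases i with i | i
    · exact hX a₀ (hs a₀ ha₀) i
    · exact norm_conj_le (hTu a ha) (hZ a₀ (hs a₀ ha₀) i)
  have key (a) (ha : a ∈ s₂) (j) :
      twoNorm (matTrace k) (a j - U a * (Q j).eval (E a) * (U a)ᴴ) ≤ 3 * ω / 20 := by
    have hUU : U a * (U a)ᴴ = 1 := (Unitary.mem_iff.1 (hU a ha)).2
    have h := twoNorm_eval_sub_conj_le (ι := Fin p ⊕ Fin q) (a := Sum.elim (X a) (Z a))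
      (δ := ω') hk hC (hU a ha) (fun i => by
        rcases i with i | i
        exacts [hX a (hs a ha) i, hZ a (hs a ha) i]) (hE a ha) (fun i => by
        rcases i with i | i
        · exact (hUX a ha i).le
        · have e : U a * E a (Sum.inr i) * (U a)ᴴ = V a * Z a₀ i * (V a)ᴴ := by
            simp only [E, Sum.elim_inr, hT, Matrix.conjTranspose_mul,
              Matrix.conjTranspose_conjTranspose]
            calc _ = (U a * (U a)ᴴ) * V a * Z a₀ i * (V a)ᴴ * (U a * (U a)ᴴ) := by
                  simp only [mul_assoc]
              _ = _ := by rw [hUU, one_mul, mul_one]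
          rw [e]
          exact (hVZ a ha i).le) (Q j)
    linarith [hτ.twoNorm_sub_le (a j) ((Q j).eval (Sum.elim (X a) (Z a)))
      (U a * (Q j).eval (E a) * (U a)ᴴ), hQ a (hs a ha) j, hQω j]
  have hUb : (U b)ᴴ * U b = 1 := (Unitary.mem_iff.1 (hU b hb)).1
  have hW : U a * (U b)ᴴ ∈ Matrix.unitaryGroup (Fin k) ℂ :=
    mul_mem (hU a ha) (Unitary.star_mem (hU b hb))
  refine ⟨U a * (U b)ᴴ, hW, fun j => ?_⟩
  have d1 : twoNorm (matTrace k) (U a * (Q j).eval (E a) * (U a)ᴴ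
      - U a * (Q j).eval (E b) * (U a)ᴴ) ≤ ω / 20 := by
    rw [← sub_mul, ← mul_sub]
    refine (hτ.twoNorm_conj_le (hU a ha) _).trans (le_trans ?_ (hQθ j))
    refine StarPoly.twoNorm_eval_sub_le hτ hC (hE a ha) (hE b hb) (fun i => ?_) (Q j)
    rcases i with i | i
    · simp only [E, Sum.elim_inl, sub_self, twoNorm_zero]; positivity
    · exact hτ.twoNorm_conj_sub_conj_le (hTu a ha) (hTu b hb) (hZ a₀ (hs a₀ ha₀) i) hab.le
  have d2 : twoNorm (matTrace k) (U a * (Q j).eval (E b) * (U a)ᴴ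
      - U a * (U b)ᴴ * b j * (U a * (U b)ᴴ)ᴴ) ≤ 3 * ω / 20 := by
    have e : U a * (Q j).eval (E b) * (U a)ᴴ - U a * (U b)ᴴ * b j * (U a * (U b)ᴴ)ᴴ
        = U a * (U b)ᴴ * (U b * (Q j).eval (E b) * (U b)ᴴ - b j) * star (U a * (U b)ᴴ) := by
      rw [mul_sub, sub_mul]
      congr 1
      rw [Matrix.star_eq_conjTranspose, Matrix.conjTranspose_mul,
        Matrix.conjTranspose_conjTranspose]
      calc _ = U a * 1 * (Q j).eval (E b) * 1 * (U a)ᴴ := by simp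
        _ = _ := by rw [← hUb]; simp only [mul_assoc]
    rw [e]
    refine (hτ.twoNorm_conj_le hW _).trans ?_
    rw [twoNorm_sub_comm]
    exact key b hb j
  linarith [key a ha j, hτ.twoNorm_sub_le (a j) (U a * (Q j).eval (E a) * (U a)ᴴ)
    (U a * (U b)ᴴ * b j * (U a * (U b)ᴴ)ᴴ), hτ.twoNorm_sub_le (U a * (Q j).eval (E a) * (U a)ᴴ)
    (U a * (Q j).eval (E b) * (U a)ᴴ) (U a * (U b)ᴴ * b j * (U a * (U b)ᴴ)ᴴ)]

variable {A : Type*} [CStarAlgebra A] {τ : A →ₗ[ℂ] ℂ}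

/-- The C⋆-algebraic core of the argument: if `x` and `z` have negligible orbit spaces,
together generate `y` (and are generated by it) in the sense of bounded `2`-norm approximation,
and there are arbitrarily fine partitions of unity into projections generated both by `x` and by
`z`, then `y` has negligible orbit spaces. -/
theorem negligibleOrbits_of_amalgam [Nontrivial A] (hτ : IsTrace τ) {n p q : ℕ} {y : Fin n → A}
    {x : Fin p → A} {z : Fin q → A} (hx : ∀ j, BoundedApprox τ y (x j))
    (hz : ∀ j, BoundedApprox τ y (z j))
    (hy : ∀ j, ∀ δ > 0, ∃ Q : StarPoly (Fin p ⊕ Fin q),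
      twoNorm τ (y j - Q.eval (Sum.elim x z)) ≤ δ)
    (he : ∀ β > 0, ∃ (r : ℕ) (e : Fin r → A), (∀ l, IsStarProjection (e l)) ∧ ∑ l, e l = 1 ∧
      ∑ l, twoNorm τ (e l) ^ 4 ≤ β ∧ ∀ l, BoundedApprox τ x (e l) ∧ BoundedApprox τ z (e l))
    (hnx : NegligibleOrbits τ x) (hnz : NegligibleOrbits τ z) : NegligibleOrbits τ y := by
  intro R₀ hR₀ ω hω α hα
  -- bounds for the operator norms of all tuples involved
  set R := max R₀ (∑ j, ‖y j‖)
  have hyR (j) : ‖y j‖ ≤ R := (Finset.single_le_sum (fun j _ => norm_nonneg (y j))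
    (Finset.mem_univ j)).trans (le_max_right _ _)
  let w : Fin p ⊕ Fin q → A := Sum.elim x z
  have hw (i) : BoundedApprox τ y (w i) := by
    rcases i with i | i
    exacts [hx i, hz i]
  choose c hc using hw
  set C := 1 + ∑ i, (|c i| + ‖w i‖) with hCdef
  have hCi (i) : |c i| + ‖w i‖ ≤ C := by
    have := Finset.single_le_sum (f := fun i => |c i| + ‖w i‖)
      (fun i _ => by positivity) (Finset.mem_univ i)
    rw [hCdef]; linarith
  have hC0 : 0 < C := by rw [hCdef]; positivity
  have hcC (i) : c i ≤ C := by linarith [hCi i, le_abs_self (c i), norm_nonneg (w i)]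
  have hwC (i) : ‖w i‖ ≤ C := by linarith [hCi i, abs_nonneg (c i)]
  choose Q hQ using fun j => hy j (ω / 20) (by positivity)
  set LQ := 1 + ∑ j, (Q j).lip C with hLQ
  have hlipQ (j) : (Q j).lip C ≤ LQ := by
    have := Finset.single_le_sum (f := fun j => (Q j).lip C)
      (fun j _ => StarPoly.lip_nonneg hC0.le _) (Finset.mem_univ j)
    rw [hLQ]; linarith
  have hLQ0 : 0 < LQ := by
    have := Finset.sum_nonneg (f := fun j => (Q j).lip C) (s := Finset.univ)
      (fun j _ => StarPoly.lip_nonneg hC0.le _)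
    rw [hLQ]; linarith
  -- the precision `θ` for the relative unitaries, and the number of projections
  set θ := ω / 20 / (LQ * (2 * C)) with hθdef
  have hθ : 0 < θ := by positivity
  have hQθ (j) : (Q j).lip C * (2 * C * θ) ≤ ω / 20 := by
    calc (Q j).lip C * (2 * C * θ) ≤ LQ * (2 * C * θ) := by gcongr; exact hlipQ j
      _ = ω / 20 := by rw [hθdef]; field_simp
  obtain ⟨κ, hκ, hcol⟩ := exists_colorable_almost_commutant hθ
  obtain ⟨r, e, heproj, hesum, heβ, heapp⟩ := he (α / (4 * κ)) (by positivity)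
  obtain ⟨η, hη, hcol⟩ := hcol r
  obtain ⟨ρ, hρ0, hρ⟩ : ∃ ρ > 0, ∑ l, (twoNorm τ (e l) + ρ) ^ 4 ≤ α / (2 * κ) := by
    have ht : Tendsto (fun ρ : ℝ => ∑ l, (twoNorm τ (e l) + ρ) ^ 4) (𝓝[>] 0)
        (𝓝 (∑ l, (twoNorm τ (e l) + 0) ^ 4)) :=
      (Continuous.tendsto (by fun_prop) 0).mono_left nhdsWithin_le_nhds
    simp only [add_zero] at ht
    have hlt : ∑ l, twoNorm τ (e l) ^ 4 < α / (2 * κ) :=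
      heβ.trans_lt (div_lt_div_of_pos_left hα (by positivity) (by linarith))
    obtain ⟨ρ, h1, h2⟩ := ((ht.eventually_lt_const hlt).and self_mem_nhdsWithin).exists
    exact ⟨ρ, h2, h1.le⟩
  -- polynomials approximating the projections
  set δ₁ := min (η / 16) (min (η / (2 * (r + 1))) (ρ / 2))
  have hδ₁ : 0 < δ₁ := by positivity
  have hδη : δ₁ ≤ η / 16 := min_le_left _ _
  have hδr : δ₁ ≤ η / (2 * (r + 1)) := (min_le_right _ _).trans (min_le_left _ _)
  have hδρ : δ₁ ≤ ρ / 2 := (min_le_right _ _).trans (min_le_right _ _)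
  obtain ⟨f, hfH, hfe, hff⟩ := exists_selfAdjoint_approx hτ heproj (fun l => (heapp l).1) δ₁ hδ₁
  obtain ⟨g, -, hge, -⟩ := exists_selfAdjoint_approx hτ heproj (fun l => (heapp l).2) δ₁ hδ₁
  set Λ := 1 + (∑ l, (f l).lip C + ∑ l, (g l).lip C) with hΛ
  have hΛf (l) : (f l).lip C ≤ Λ := by
    have h1 := Finset.single_le_sum (f := fun l => (f l).lip C)
      (fun j _ => StarPoly.lip_nonneg hC0.le _) (Finset.mem_univ l)
    have h2 := Finset.sum_nonneg (f := fun l => (g l).lip C) (s := Finset.univ)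
      (fun j _ => StarPoly.lip_nonneg hC0.le _)
    rw [hΛ]; linarith
  have hΛg (l) : (g l).lip C ≤ Λ := by
    have h1 := Finset.single_le_sum (f := fun l => (g l).lip C)
      (fun j _ => StarPoly.lip_nonneg hC0.le _) (Finset.mem_univ l)
    have h2 := Finset.sum_nonneg (f := fun l => (f l).lip C) (s := Finset.univ)
      (fun j _ => StarPoly.lip_nonneg hC0.le _)
    rw [hΛ]; linarith
  have hΛ0 : 0 < Λ := by
    have h1 := Finset.sum_nonneg (f := fun l => (g l).lip C) (s := Finset.univ)
      (fun j _ => StarPoly.lip_nonneg hC0.le _)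
    have h2 := Finset.sum_nonneg (f := fun l => (f l).lip C) (s := Finset.univ)
      (fun j _ => StarPoly.lip_nonneg hC0.le _)
    rw [hΛ]; linarith
  -- the precision `ω'` for the orbits of the microstates of `x` and `z`
  set ω' := min (η / 4 / Λ) (ω / 20 / LQ)
  have hω' : 0 < ω' := by positivity
  have hΛω : Λ * ω' ≤ η / 4 := by
    rw [mul_comm]; exact (le_div_iff₀ hΛ0).1 (min_le_left _ _)
  have hLω : LQ * ω' ≤ ω / 20 := by
    rw [mul_comm]; exact (le_div_iff₀ hLQ0).1 (min_le_right _ _)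
  obtain ⟨m₁, ε₁, hε₁, hk₁⟩ := hnx C hC0 ω' hω' (α / 4) (by positivity)
  obtain ⟨m₂, ε₂, hε₂, hk₂⟩ := hnz C hC0 ω' hω' (α / 4) (by positivity)
  -- polynomials approximating `x` and `z`
  have t1 := eventually_eval_mem_microstates hτ y R hC0.le (fun j => hwC (.inl j)) m₁ hε₁
  have t2 := eventually_eval_mem_microstates hτ y R hC0.le (fun j => hwC (.inr j)) m₂ hε₂
  have t3 : ∀ᶠ δ in 𝓝[>] (0 : ℝ), ω / 20 + LQ * δ < ω / 10 :=
    eventually_add_mul_lt _ _ (by linarith)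
  have t4 := eventually_all.2 fun l => eventually_twoNorm_eval_lt hτ y R hC0.le hwC
    ((f l).mul (f l) |>.sub (f l)).inl (c := η) (by
      simp only [StarPoly.eval_subst, StarPoly.eval_sub, StarPoly.eval]
      exact (hff l).trans_lt (by linarith))
  have t5 := eventually_twoNorm_eval_lt hτ y R hC0.le hwC
    ((StarPoly.const 1).sub (StarPoly.finSum f)).inl (c := η) (by
      simp only [StarPoly.eval_subst, StarPoly.eval_sub, StarPoly.eval, StarPoly.eval_finSum,
        map_one]
      rw [← hesum, ← Finset.sum_sub_distrib]
      refine (hτ.twoNorm_sum_le _ _).trans_lt ?_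
      refine lt_of_le_of_lt (Finset.sum_le_sum fun l _ => (hfe l).trans hδr) ?_
      rw [Finset.sum_const, Finset.card_univ, Fintype.card_fin, nsmul_eq_mul, mul_div_assoc',
        div_lt_iff₀ (by positivity)]
      nlinarith)
  have t6 := eventually_all.2 fun l => eventually_twoNorm_eval_lt hτ y R hC0.le hwC
    (f l).inl (c := twoNorm τ (e l) + ρ) (by
      simp only [StarPoly.eval_subst, StarPoly.eval]
      have h1 := hτ.twoNorm_sub_le ((f l).eval x) (e l) 0
      rw [sub_zero, sub_zero, twoNorm_sub_comm] at h1
      exact lt_of_le_of_lt h1 (by linarith [hfe l]))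
  have t7 := eventually_all.2 fun l => eventually_twoNorm_eval_lt hτ y R hC0.le hwC
    ((f l).inl.sub (g l).inr) (c := η / 4) (by
      simp only [StarPoly.eval_sub, StarPoly.eval_subst, StarPoly.eval]
      have h1 := hτ.twoNorm_sub_le ((f l).eval x) (e l) ((g l).eval z)
      rw [twoNorm_sub_comm _ (e l)] at h1
      exact lt_of_le_of_lt h1 (by linarith [hfe l, hge l]))
  obtain ⟨δ, ⟨t1, t2, t3, t4, t5, t6, t7⟩, hδ⟩ := ((t1.and (t2.and (t3.and (t4.and
    (t5.and (t6.and t7)))))).and self_mem_nhdsWithin).exists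
  have hδ : 0 < δ := hδ
  choose P hPy hPw hPb using fun i => hc i R hyR δ hδ
  have hPy' (i) : ‖(P i).eval y‖ ≤ C := (hPy i).trans (hcC i)
  have hPb' (i) (k : ℕ) (hk : 0 < k) (b : Fin n → Matrix (Fin k) (Fin k) ℂ)
      (hb : ∀ i, ‖b i‖ ≤ R) : ‖(P i).eval b‖ ≤ C := (hPb i k hk b hb).trans (hcC i)
  have s1 := t1 (fun j => P (.inl j)) (fun j => hPy' _) (fun j => hPw _)
    (fun k hk b hb j => hPb' _ k hk b hb)
  have s2 := t2 (fun j => P (.inr j)) (fun j => hPy' _) (fun j => hPw _)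
    (fun k hk b hb j => hPb' _ k hk b hb)
  have s3 : ∀ᶠ s in microFilter τ y R, ∀ j, twoNorm (matTrace s.1)
      (((StarPoly.var j).sub ((Q j).subst P)).eval s.2) < ω / 10 := by
    refine eventually_all.2 fun j => eventually_twoNorm_lt hτ R (lt_of_le_of_lt ?_ t3)
    rw [StarPoly.eval_sub, StarPoly.eval_subst, StarPoly.eval]
    have h1 := StarPoly.twoNorm_eval_sub_le hτ hC0.le hwC hPy' hPw (Q j)
    have h2 := mul_le_mul_of_nonneg_right (hlipQ j) hδ.le
    linarith [hτ.twoNorm_sub_le (y j) ((Q j).eval w) ((Q j).eval fun i => (P i).eval y), hQ j]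
  have s4 := eventually_all.2 fun l => t4 l P hPy' hPw
  have s5 := t5 P hPy' hPw
  have s6 := eventually_all.2 fun l => t6 l P hPy' hPw
  have s7 := eventually_all.2 fun l => t7 l P hPy' hPw
  obtain ⟨m, hm⟩ := eventually_microFilter.1 (s1.and (s2.and (s3.and (s4.and
    (s5.and (s6.and s7))))))
  refine ⟨m, 1 / ((m : ℝ) + 1), by positivity, ?_⟩
  filter_upwards [hk₁, hk₂, eventually_gt_atTop 0] with k hk₁ hk₂ hk
  have hm' (a) (ha : a ∈ microstates τ y R₀ m k (1 / ((m : ℝ) + 1))) :=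
    hm k hk a (microstates_mono (le_max_left _ _) le_rfl le_rfl ha)
  let X (a : Fin n → Matrix (Fin k) (Fin k) ℂ) (j : Fin p) := (P (.inl j)).eval a
  let Z (a : Fin n → Matrix (Fin k) (Fin k) ℂ) (j : Fin q) := (P (.inr j)).eval a
  have hXZ (a) : (fun i => (P i).eval a) = Sum.elim (X a) (Z a) := by
    ext1 i; rcases i with i | i <;> rfl
  have hexp : Real.exp (α / 4 * (k : ℝ) ^ 2) * (Real.exp (α / 4 * (k : ℝ) ^ 2) *
      Real.exp (κ * (α / (2 * κ)) * (k : ℝ) ^ 2)) = Real.exp (α * (k : ℝ) ^ 2) := by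
    rw [← Real.exp_add, ← Real.exp_add]
    congr 1
    field_simp
    ring
  rw [← hexp]
  refine colorable_of_almost_commutant hk X Z (η := η) (ω' := ω') (θ := θ) hC0.le hω
    (fun a ha j => (hm' a ha).1.1 j) (fun a ha j => (hm' a ha).2.1.1 j) Q (fun a ha j => ?_)
    (fun j => (mul_le_mul_of_nonneg_right (hlipQ j) hω'.le).trans hLω) hQθ hθ.le f g
    (fun a ha l => ?_) (fun l => (mul_le_mul_of_nonneg_right (hΛf l) hω'.le).trans hΛω)
    (fun l => (mul_le_mul_of_nonneg_right (hΛg l) hω'.le).trans hΛω) (Real.exp_pos _).le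
    (Real.exp_pos _).le (hk₁.comap X fun a ha => (hm' a ha).1)
    (hk₂.comap Z fun a ha => (hm' a ha).2.1) (fun a ha => ?_)
  · have := ((hm' a ha).2.2.1 j).le
    rwa [StarPoly.eval_sub, StarPoly.eval_subst, hXZ] at this
  · have := ((hm' a ha).2.2.2.2.2.2 l).le
    simpa only [StarPoly.eval_sub, StarPoly.eval_subst, StarPoly.eval] using this
  · obtain ⟨-, -, -, u4, u5, u6, -⟩ := hm' a ha
    refine hcol η le_rfl hη.le k hk (fun l => (f l).eval (X a)) _ (fun l => hfH l k _)
      (fun l => ?_) ?_ ?_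
    · have := (u4 l).le
      simpa only [StarPoly.eval_sub, StarPoly.eval_subst, StarPoly.eval] using this
    · have := u5.le
      simpa only [StarPoly.eval_sub, StarPoly.eval_subst, StarPoly.eval, StarPoly.eval_finSum,
        map_one] using this
    · refine le_trans (Finset.sum_le_sum fun l _ => pow_le_pow_left₀ (twoNorm_nonneg _) ?_ 4) hρ
      have := (u6 l).le
      simpa only [StarPoly.eval_subst, StarPoly.eval] using this

/-! ### Bounded approximation by `*`-polynomials -/

section Kaplansky

variable {A : Type*} [CStarAlgebra A] {τ : A →ₗ[ℂ] ℂ}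

/-- Kaplansky's function `t ↦ 2t / (1 + t²)`, which maps `ℝ` to `[-1, 1]`. -/
def kaplansky (t : ℝ) : ℝ := 2 * t / (1 + t ^ 2)

lemma continuous_kaplansky : Continuous kaplansky :=
  Continuous.div (by fun_prop) (by fun_prop) fun t => by positivity

lemma abs_kaplansky_le (t : ℝ) : |kaplansky t| ≤ 1 := by
  rw [kaplansky, abs_div, abs_of_pos (by positivity : 0 < 1 + t ^ 2), div_le_one (by positivity),
    abs_le]
  constructor <;> nlinarith [sq_nonneg (t - 1), sq_nonneg (t + 1)]

/-- The inverse of Kaplansky's function on `[-1, 1]`. -/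
def kaplanskyInv (t : ℝ) : ℝ := t / (1 + Real.sqrt (1 - t ^ 2))

lemma continuous_kaplanskyInv : Continuous kaplanskyInv :=
  Continuous.div (by fun_prop) (by fun_prop) fun t => by positivity

lemma kaplansky_kaplanskyInv {t : ℝ} (ht : |t| ≤ 1) : kaplansky (kaplanskyInv t) = t := by
  have h1 : 0 ≤ 1 - t ^ 2 := by nlinarith [sq_abs t, abs_nonneg t]
  have h2 := Real.sq_sqrt h1
  have h3 := Real.sqrt_nonneg (1 - t ^ 2)
  rw [kaplansky, kaplanskyInv]
  set s := Real.sqrt (1 - t ^ 2)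
  have h4 : 1 + s ≠ 0 := by positivity
  rw [div_eq_iff (by positivity)]
  field_simp
  linear_combination (-t) * h2

lemma norm_cfc_real_le {a : A} {f : ℝ → ℝ} {c : ℝ} (hc : 0 ≤ c) (h : ∀ x, |x| ≤ ‖a‖ → |f x| ≤ c) :
    ‖cfc f a‖ ≤ c := by
  rcases subsingleton_or_nontrivial A with _ | _
  · simpa [Subsingleton.elim (cfc f a) 0] using hc
  exact norm_cfc_le hc fun x hx => h x (spectrum.norm_le_norm_of_mem hx)

/-- Kaplansky's function is Lipschitz for the `2`-norm. -/
lemma IsTrace.twoNorm_cfc_kaplansky_sub_le (hτ : IsTrace τ) {a b : A} (ha : IsSelfAdjoint a)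
    (hb : IsSelfAdjoint b) :
    twoNorm τ (cfc kaplansky a - cfc kaplansky b) ≤ 4 * twoNorm τ (a - b) := by
  let u (t : ℝ) : ℝ := (1 + t ^ 2)⁻¹
  have hu : Continuous u := Continuous.inv₀ (by fun_prop) fun t => by positivity
  let v (t : ℝ) : ℝ := u t * t
  have hv : Continuous v := hu.mul continuous_id
  have hv1 (t : ℝ) : |v t| ≤ 1 := by
    have : v t = kaplansky t / 2 := by simp only [v, u, kaplansky]; field_simp
    rw [this, abs_div, abs_two]
    linarith [abs_kaplansky_le t]
  have hu1 (t : ℝ) : |u t| ≤ 1 := by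
    simp only [u]
    rw [abs_of_pos (by positivity)]
    exact inv_le_one_of_one_le₀ (by nlinarith [sq_nonneg t])
  have nu (c : A) : ‖cfc u c‖ ≤ 1 := norm_cfc_real_le zero_le_one fun x _ => hu1 x
  have nv (c : A) : ‖cfc v c‖ ≤ 1 := norm_cfc_real_le zero_le_one fun x _ => hv1 x
  have mulr (f : ℝ → ℝ) (hf : Continuous f) (c : A) (hc : IsSelfAdjoint c) :
      cfc f c * c = cfc (fun t => f t * t) c := by
    conv_lhs => enter [2]; rw [← cfc_id' ℝ c]
    rw [← cfc_mul f (fun x => x) c hf.continuousOn continuousOn_id]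
  have mull (f : ℝ → ℝ) (hf : Continuous f) (c : A) (hc : IsSelfAdjoint c) :
      c * cfc f c = cfc (fun t => f t * t) c := by
    conv_lhs => enter [1]; rw [← cfc_id' ℝ c]
    rw [← cfc_mul (fun x => x) f c continuousOn_id hf.continuousOn]
    exact congrArg (fun f => cfc f c) (funext fun t => mul_comm _ _)
  have hone (c : A) (hc : IsSelfAdjoint c) : cfc u c + cfc (fun t => v t * t) c = 1 := by
    rw [← cfc_add c u (fun t => v t * t) hu.continuousOn (hv.mul continuous_id).continuousOn]
    have : (fun t => u t + v t * t) = fun _ => (1 : ℝ) := by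
      ext t
      simp only [v, u]
      field_simp
    rw [this, cfc_const_one ℝ c]
  have hk (c : A) : cfc kaplansky c = (2 : ℂ) • cfc v c := by
    have e : kaplansky = fun t => 2 * v t := by
      ext t; simp only [kaplansky, v, u]; field_simp
    rw [e, cfc_const_mul 2 v c hv.continuousOn, ← Complex.coe_smul]; norm_num
  -- the resolvent identity `v(a) - v(b) = u(a) (a - b) u(b) - v(a) (a - b) v(b)`
  have e : cfc v a - cfc v b = cfc u a * (a - b) * cfc u b - cfc v a * (a - b) * cfc v b := by
    have a1 := mulr u hu a ha
    have b1 := mull u hu b hb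
    have a2 := hone a ha
    have b2 := hone b hb
    rw [← mulr v hv a ha] at a2
    rw [← mull v hv b hb] at b2
    change _ = cfc v a at a1
    change _ = cfc v b at b1
    calc cfc v a - cfc v b
        = cfc v a * (cfc u b + b * cfc v b) - (cfc u a + cfc v a * a) * cfc v b := by
          rw [a2, b2, mul_one, one_mul]
      _ = cfc v a * cfc u b - cfc u a * cfc v b - cfc v a * (a - b) * cfc v b := by
          simp only [mul_add, add_mul, mul_sub, sub_mul, mul_assoc]; abel
      _ = _ := by
          rw [← a1, ← b1]
          simp only [mul_sub, sub_mul, mul_assoc]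
  have le (x y : A) (hx : ‖x‖ ≤ 1) (hy : ‖y‖ ≤ 1) :
      twoNorm τ (x * (a - b) * y) ≤ twoNorm τ (a - b) :=
    (hτ.twoNorm_mul_le' _ _).trans ((mul_le_of_le_one_right (twoNorm_nonneg _) hy).trans
      ((hτ.twoNorm_mul_le _ _).trans (mul_le_of_le_one_left (twoNorm_nonneg _) hx)))
  rw [hk, hk, ← smul_sub, twoNorm_smul, Complex.norm_ofNat, e]
  have h1 := hτ.twoNorm_sub_le (cfc u a * (a - b) * cfc u b) 0 (cfc v a * (a - b) * cfc v b)
  rw [sub_zero, zero_sub, twoNorm_neg] at h1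
  linarith [le _ _ (nu a) (nu b), le _ _ (nv a) (nv b)]

/-- If `f` is close to Kaplansky's function on `[-B, B]`, then `f(b)` is close to the value of
Kaplansky's function at `b`, for every self-adjoint `b` with norm at most `B`. -/
lemma norm_aeval_sub_cfc_kaplansky_le {b : A} (hb : IsSelfAdjoint b) {B δ : ℝ} (hδ : 0 ≤ δ)
    (hbB : ‖b‖ ≤ B) {f : Polynomial ℝ} (hf : ∀ x ∈ Set.Icc (-B) B, |f.eval x - kaplansky x| < δ) :
    ‖Polynomial.aeval b f - cfc kaplansky b‖ ≤ δ := by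
  rw [← cfc_polynomial f b, ← cfc_sub (fun x => f.eval x) kaplansky b
    f.continuous.continuousOn continuous_kaplansky.continuousOn]
  exact norm_cfc_real_le hδ fun x hx => (hf x (abs_le.1 (hx.trans hbB))).le

variable {n : ℕ} {y : Fin n → A}

lemma BoundedApprox.add (hτ : IsTrace τ) {a b : A} (ha : BoundedApprox τ y a)
    (hb : BoundedApprox τ y b) : BoundedApprox τ y (a + b) := by
  obtain ⟨C, hC⟩ := ha
  obtain ⟨D, hD⟩ := hb
  refine ⟨C + D, fun R hR δ hδ => ?_⟩
  obtain ⟨P, h1, h2, h3⟩ := hC R hR (δ / 2) (half_pos hδ)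
  obtain ⟨Q, g1, g2, g3⟩ := hD R hR (δ / 2) (half_pos hδ)
  refine ⟨.add P Q, (norm_add_le _ _).trans (add_le_add h1 g1), ?_,
    fun k hk b hb => (norm_add_le _ _).trans (add_le_add (h3 k hk b hb) (g3 k hk b hb))⟩
  rw [StarPoly.eval, add_sub_add_comm]
  linarith [hτ.twoNorm_add_le (a - P.eval y) (b - Q.eval y)]

lemma BoundedApprox.smul {a : A} (ha : BoundedApprox τ y a) (c : ℂ) :
    BoundedApprox τ y (c • a) := by
  obtain ⟨C, hC⟩ := ha
  refine ⟨‖c‖ * C, fun R hR δ hδ => ?_⟩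
  obtain ⟨P, h1, h2, h3⟩ := hC R hR (δ / (‖c‖ + 1)) (by positivity)
  refine ⟨.mul (.const c) P, ?_, ?_, fun k hk b hb => ?_⟩
  · rw [StarPoly.eval, StarPoly.eval, ← Algebra.smul_def, norm_smul]; gcongr
  · rw [StarPoly.eval, StarPoly.eval, ← Algebra.smul_def, ← smul_sub, twoNorm_smul]
    calc ‖c‖ * twoNorm τ (a - P.eval y) ≤ ‖c‖ * (δ / (‖c‖ + 1)) := by gcongr
      _ ≤ δ := by
        rw [mul_div_assoc', div_le_iff₀ (by positivity)]
        nlinarith [norm_nonneg c]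
  · rw [StarPoly.eval, StarPoly.eval, ← Algebra.smul_def, norm_smul]
    exact mul_le_mul_of_nonneg_left (h3 k hk b hb) (norm_nonneg c)

lemma boundedApprox_of_norm_le_one [Nontrivial A] (hτ : IsTrace τ)
    (hy : ∀ g : A, ∀ δ > 0, ∃ Q : StarPoly (Fin n), twoNorm τ (g - Q.eval y) ≤ δ)
    {a : A} (ha : IsSelfAdjoint a) (ha1 : ‖a‖ ≤ 1) : BoundedApprox τ y a := by
  refine ⟨2, fun R hR δ hδ => ?_⟩
  set g := cfc kaplanskyInv a with hg
  have hgs : IsSelfAdjoint g := cfc_predicate _ a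
  have hag : a = cfc kaplansky g := by
    rw [hg, ← cfc_comp kaplansky kaplanskyInv a ha continuous_kaplansky.continuousOn
      continuous_kaplanskyInv.continuousOn]
    conv_lhs => rw [← cfc_id ℝ a]
    refine cfc_congr fun x hx => (kaplansky_kaplanskyInv ?_).symm
    exact (spectrum.norm_le_norm_of_mem hx).trans ha1
  obtain ⟨Q, hQ⟩ := hy g (δ / 8) (by positivity)
  set B := Q.realPart.bound (max R 0)
  have hR0 : 0 ≤ max R 0 := le_max_right _ _
  obtain ⟨f, hf⟩ := exists_polynomial_near_of_continuousOn (-B) B kaplansky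
    continuous_kaplansky.continuousOn (min 1 (δ / 2)) (by positivity)
  have hclose : twoNorm τ (g - Q.realPart.eval y) ≤ δ / 8 :=
    (hτ.twoNorm_sub_eval_realPart_le hgs y Q).trans hQ
  have hbdy : ∀ j, ‖y j‖ ≤ max R 0 := fun j => (hR j).trans (le_max_left _ _)
  have happ := norm_aeval_sub_cfc_kaplansky_le (StarPoly.isSelfAdjoint_eval_realPart y Q)
    (by positivity) (StarPoly.norm_eval_le hR0 hbdy _) hf
  have hev : (StarPoly.comp f Q.realPart).eval y = Polynomial.aeval (Q.realPart.eval y) f := by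
    rw [StarPoly.eval_comp]; exact Polynomial.aeval_map_algebraMap ℂ _ f
  refine ⟨.comp f Q.realPart, ?_, ?_, fun k hk b hb => ?_⟩
  · rw [hev]
    have h2 : ‖cfc kaplansky (Q.realPart.eval y)‖ ≤ 1 :=
      norm_cfc_real_le zero_le_one fun x _ => abs_kaplansky_le x
    linarith [min_le_left 1 (δ / 2), norm_le_norm_sub_add (Polynomial.aeval (Q.realPart.eval y) f)
      (cfc kaplansky (Q.realPart.eval y))]
  · rw [hev, hag]
    have h1 := hτ.twoNorm_cfc_kaplansky_sub_le hgs (StarPoly.isSelfAdjoint_eval_realPart y Q)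
    have h2 := hτ.twoNorm_le_norm
      (Polynomial.aeval (Q.realPart.eval y) f - cfc kaplansky (Q.realPart.eval y))
    rw [twoNorm_sub_comm] at h2
    linarith [min_le_right 1 (δ / 2), hτ.twoNorm_sub_le (cfc kaplansky g)
      (cfc kaplansky (Q.realPart.eval y)) (Polynomial.aeval (Q.realPart.eval y) f)]
  · have := nontrivial_matrix hk
    have hbR : ∀ j, ‖b j‖ ≤ max R 0 := fun j => (hb j).trans (le_max_left _ _)
    have happ := norm_aeval_sub_cfc_kaplansky_le (StarPoly.isSelfAdjoint_eval_realPart b Q)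
      (by positivity) (StarPoly.norm_eval_le hR0 hbR _) hf
    have hev : (StarPoly.comp f Q.realPart).eval b = Polynomial.aeval (Q.realPart.eval b) f := by
      rw [StarPoly.eval_comp]; exact Polynomial.aeval_map_algebraMap ℂ _ f
    rw [hev]
    have h2 : ‖cfc kaplansky (Q.realPart.eval b)‖ ≤ 1 :=
      norm_cfc_real_le zero_le_one fun x _ => abs_kaplansky_le x
    linarith [min_le_left 1 (δ / 2), norm_le_norm_sub_add (Polynomial.aeval (Q.realPart.eval b) f)
      (cfc kaplansky (Q.realPart.eval b))]

/-- A Kaplansky density theorem: if the `*`-polynomials in `y` are `2`-norm dense, then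
every element is a `2`-norm limit of `*`-polynomials which are uniformly bounded, also at matrix
tuples. -/
theorem boundedApprox_of_dense [Nontrivial A] (hτ : IsTrace τ)
    (hy : ∀ g : A, ∀ δ > 0, ∃ Q : StarPoly (Fin n), twoNorm τ (g - Q.eval y) ≤ δ) (a : A) :
    BoundedApprox τ y a := by
  have sa (b : A) (hb : IsSelfAdjoint b) : BoundedApprox τ y b := by
    have hpos : (0 : ℝ) < ‖b‖ + 1 := by positivity
    have h1 : IsSelfAdjoint ((((‖b‖ + 1)⁻¹ : ℝ) : ℂ) • b) :=
      IsSelfAdjoint.smul (Complex.conj_ofReal _) hb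
    have h2 : ‖(((‖b‖ + 1)⁻¹ : ℝ) : ℂ) • b‖ ≤ 1 := by
      rw [norm_smul, Complex.norm_real, Real.norm_of_nonneg (by positivity),
        inv_mul_le_iff₀ hpos]
      linarith
    have h3 := (boundedApprox_of_norm_le_one hτ hy h1 h2).smul ((‖b‖ + 1 : ℝ) : ℂ)
    rwa [smul_smul, ← Complex.ofReal_mul, mul_inv_cancel₀ hpos.ne', Complex.ofReal_one,
      one_smul] at h3
  rw [← realPart_add_I_smul_imaginaryPart a]
  exact (sa _ (realPart a).2).add hτ ((sa _ (imaginaryPart a).2).smul _)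

end Kaplansky

end

/-! ### The double commutant theorem and `2`-norm density -/

section Amplification

variable {H : Type u} [NormedAddCommGroup H]

/-- The Hilbert space `ℓ²(ℕ, H)`. -/
abbrev EllTwo (H : Type u) [NormedAddCommGroup H] : Type u := lp (fun _ : ℕ => H) 2

lemma EllTwo.norm_sq (ξ : EllTwo H) : ‖ξ‖ ^ 2 = ∑' i, ‖ξ i‖ ^ 2 := by
  simpa using lp.norm_rpow_eq_tsum (p := 2) (by norm_num) ξ

lemma EllTwo.summable_norm_sq (ξ : EllTwo H) : Summable fun i => ‖ξ i‖ ^ 2 := by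
  simpa using (memℓp_gen_iff (by norm_num)).1 (lp.memℓp ξ)

variable [InnerProductSpace ℂ H]

/-- The image of `ξ` under the diagonal action of `T` on `ℓ²(ℕ, H)`. -/
def amplify (ξ : EllTwo H) (T : H →L[ℂ] H) : EllTwo H :=
  ⟨fun i => T (ξ i), by
    have h := (memℓp_gen_iff (by norm_num)).1 (lp.memℓp ξ)
    refine (memℓp_gen_iff (by norm_num)).2 ?_
    refine Summable.of_nonneg_of_le (fun i => by positivity) (fun i => ?_) (h.mul_left (‖T‖ ^ 2))
    simp only [ENNReal.toReal_ofNat, Real.rpow_ofNat]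
    rw [← mul_pow]
    exact pow_le_pow_left₀ (norm_nonneg _) (T.le_opNorm _) 2⟩

@[simp] lemma amplify_apply (ξ : EllTwo H) (T : H →L[ℂ] H) (i : ℕ) :
    amplify ξ T i = T (ξ i) := rfl

lemma norm_amplify_le (ξ : EllTwo H) (T : H →L[ℂ] H) : ‖amplify ξ T‖ ≤ ‖T‖ * ‖ξ‖ := by
  refine le_of_sq_le_sq ?_ (by positivity)
  rw [mul_pow, EllTwo.norm_sq, EllTwo.norm_sq, ← tsum_mul_left]
  refine (amplify ξ T).summable_norm_sq.tsum_le_tsum (fun i => ?_)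
    (ξ.summable_norm_sq.mul_left _)
  rw [← mul_pow]
  exact pow_le_pow_left₀ (norm_nonneg _) (T.le_opNorm _) 2

lemma dist_amplify_le (T : H →L[ℂ] H) (ξ η : EllTwo H) :
    dist (amplify ξ T) (amplify η T) ≤ ‖T‖ * dist ξ η := by
  have e : amplify ξ T - amplify η T = amplify (ξ - η) T := by ext i; simp
  rw [dist_eq_norm, dist_eq_norm, e]
  exact norm_amplify_le _ _

/-- The sequences `ξ` and `η` can be interleaved to a sequence dominating both. -/
lemma exists_norm_amplify_le (ξ η : EllTwo H) : ∃ ζ : EllTwo H, ∀ T : H →L[ℂ] H,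
    ‖amplify ξ T‖ ≤ ‖amplify ζ T‖ ∧ ‖amplify η T‖ ≤ ‖amplify ζ T‖ := by
  let e := Equiv.natSumNatEquivNat
  have hs : Summable fun i => ‖Sum.elim (fun i => ξ i) (fun i => η i) (e.symm i)‖ ^ 2 := by
    refine (e.symm.summable_iff
      (f := fun i => ‖Sum.elim (fun i => ξ i) (fun i => η i) i‖ ^ 2)).2 ?_
    exact Summable.sum _ ξ.summable_norm_sq η.summable_norm_sq
  let ζ : EllTwo H := ⟨fun i => Sum.elim (fun i => ξ i) (fun i => η i) (e.symm i),
    (memℓp_gen_iff (by norm_num)).2 (by simpa using hs)⟩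
  refine ⟨ζ, fun T => ⟨le_of_sq_le_sq ?_ (norm_nonneg _), le_of_sq_le_sq ?_ (norm_nonneg _)⟩⟩
  · rw [EllTwo.norm_sq, EllTwo.norm_sq]
    refine le_of_eq_of_le (tsum_congr fun i => ?_) (tsum_comp_le_tsum_of_inj
      (amplify ζ T).summable_norm_sq (fun _ => sq_nonneg _)
      (e.injective.comp Sum.inl_injective))
    simp [ζ]
  · rw [EllTwo.norm_sq, EllTwo.norm_sq]
    refine le_of_eq_of_le (tsum_congr fun i => ?_) (tsum_comp_le_tsum_of_inj
      (amplify ζ T).summable_norm_sq (fun _ => sq_nonneg _)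
      (e.injective.comp Sum.inr_injective))
    simp [ζ]

end Amplification

variable {H : Type u} [NormedAddCommGroup H] [InnerProductSpace ℂ H] [CompleteSpace H]

lemma inner_amplify_left (T : H →L[ℂ] H) (ξ η : EllTwo H) :
    ⟪amplify ξ T, η⟫_ℂ = ⟪ξ, amplify η (star T)⟫_ℂ := by
  rw [lp.inner_eq_tsum, lp.inner_eq_tsum]
  refine tsum_congr fun i => ?_
  rw [amplify_apply, amplify_apply, ContinuousLinearMap.star_eq_adjoint,
    ContinuousLinearMap.adjoint_inner_right]

/-- The double commutant theorem, in the form of approximation in the ultrastrong topology: on any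
`ℓ²`-sequence of vectors, an element of the double commutant of a `*`-algebra is approximated
by elements of the algebra. -/
theorem exists_amplify_sub_lt (S : StarSubalgebra ℂ (H →L[ℂ] H)) {g : H →L[ℂ] H}
    (hg : g ∈ Set.centralizer (Set.centralizer (S : Set (H →L[ℂ] H))))
    (ξ : EllTwo H) {δ : ℝ} (hδ : 0 < δ) :
    ∃ a ∈ S, ‖amplify ξ (g - a)‖ < δ := by
  let D : (H →L[ℂ] H) →ₗ[ℂ] EllTwo H :=
    { toFun := amplify ξ
      map_add' := fun S T => by ext i; simp
      map_smul' := fun c T => by ext i; rfl }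
  let V₀ : Submodule ℂ (EllTwo H) := (Subalgebra.toSubmodule S.toSubalgebra).map D
  let V := V₀.topologicalClosure
  have : CompleteSpace V := (Submodule.isClosed_topologicalClosure V₀).completeSpace_coe
  let P := V.starProjection
  -- the diagonal action of elements of `S` preserves `V` and its orthogonal complement
  have hcont (a : H →L[ℂ] H) : Continuous fun u : EllTwo H => amplify u a :=
    (LipschitzWith.of_dist_le_mul (K := ‖a‖₊) (dist_amplify_le a)).continuous
  have hV (a) (ha : a ∈ S) (u : EllTwo H) (hu : u ∈ V) : amplify u a ∈ V := by
    refine map_mem_closure (f := fun u => amplify u a) (hcont a) hu fun v hv => ?_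
    obtain ⟨b, hb, rfl⟩ := hv
    exact ⟨a * b, S.mul_mem ha hb, rfl⟩
  have hPa (a) (ha : a ∈ S) (u : EllTwo H) : P (amplify u a) = amplify (P u) a := by
    refine Submodule.eq_starProjection_of_mem_of_inner_eq_zero
      (hV a ha _ (Submodule.starProjection_apply_mem _ _)) fun w hw => ?_
    have e : amplify u a - amplify (P u) a = amplify (u - P u) a := by
      ext i; simp
    rw [e, inner_amplify_left]
    exact Submodule.starProjection_inner_eq_zero _ _ (hV _ (star_mem ha) _ hw)
  -- hence the matrix entries of the projection onto `V` lie in the commutant of `S`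
  let p (i j : ℕ) : H →L[ℂ] H := (lp.evalCLM ℂ (fun _ : ℕ => H) 2 i) ∘L P ∘L
    (lp.singleContinuousLinearMap ℂ (fun _ : ℕ => H) 2 j)
  have hsing (a : H →L[ℂ] H) (j : ℕ) (v : H) :
      (lp.single 2 j (a v) : EllTwo H) = amplify (lp.single 2 j v) a := by
    ext i
    rcases eq_or_ne i j with rfl | h
    · simp
    · simp [h]
  have hp (i j : ℕ) : p i j ∈ Set.centralizer (S : Set (H →L[ℂ] H)) := by
    intro a ha
    ext v
    change a (P (lp.single 2 j v) i) = P (lp.single 2 j (a v)) i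
    rw [hsing, hPa a ha, amplify_apply]
  have hpg (i j : ℕ) (v : H) : P (lp.single 2 j (g v)) i = g (P (lp.single 2 j v) i) :=
    congrArg (fun T : H →L[ℂ] H => T v) (hg (p i j) (hp i j))
  have hPg (u : EllTwo H) : P (amplify u g) = amplify (P u) g := by
    have h1 := (lp.hasSum_single (p := 2) (by norm_num) (amplify u g)).mapL P
    have h2 := (lp.hasSum_single (p := 2) (by norm_num) u).mapL P
    ext i
    have h1 := h1.mapL (lp.evalCLM ℂ (fun _ : ℕ => H) 2 i)
    have h2 := (h2.mapL (lp.evalCLM ℂ (fun _ : ℕ => H) 2 i)).mapL g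
    refine h1.unique ?_
    have h3 : (fun j => P (lp.single 2 j (g (u j))) i) = fun j => g (P (lp.single 2 j (u j)) i) :=
      funext fun j => hpg i j (u j)
    have h4 : HasSum (fun j => P (lp.single 2 j (g (u j))) i) (g (P u i)) := by
      rw [h3]; exact h2
    exact h4
  have h1V : D 1 ∈ V := Submodule.le_topologicalClosure _ ⟨1, S.one_mem, rfl⟩
  have hξ : D 1 = ξ := by ext i; rfl
  have hgV : amplify ξ g ∈ V := by
    rw [hξ] at h1V
    rw [← Submodule.starProjection_eq_self_iff.2 h1V]
    rw [← hPg]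
    exact Submodule.starProjection_apply_mem _ _
  obtain ⟨w, ⟨a, ha, rfl⟩, hw⟩ := Metric.mem_closure_iff.1 hgV δ hδ
  refine ⟨a, ha, ?_⟩
  rw [dist_eq_norm] at hw
  have e : amplify ξ (g - a) = amplify ξ g - D a := (map_sub D g a)
  rwa [e]

/-- The trace tends to `0` along operators tending to `0` ultraweakly. -/
lemma IsTracialState.tendsto_zero {M : VonNeumannAlgebra H} {τ : M.toStarSubalgebra →ₗ[ℂ] ℂ}
    (hτ : IsTracialState M τ) {α : Type*} {l : Filter α} {T : α → M.toStarSubalgebra}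
    (hT : ∀ ξ η : EllTwo H, Tendsto (fun a => ⟪ξ, amplify η (T a : H →L[ℂ] H)⟫_ℂ) l (𝓝 0)) :
    Tendsto (fun a => τ (T a)) l (𝓝 0) := by
  have ht : Tendsto T l
      (@nhds _ (TopologicalSpace.induced (fun a : M.toStarSubalgebra => (a : H →L[ℂ] H))
        (ultraweakTopology H)) 0) := by
    simp only [nhds_induced, nhds_iInf, tendsto_comap_iff, tendsto_iInf]
    intro ξ η hξ hη
    let ξ' : EllTwo H := ⟨ξ, (memℓp_gen_iff (by norm_num)).2 (by simpa using hξ)⟩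
    let η' : EllTwo H := ⟨η, (memℓp_gen_iff (by norm_num)).2 (by simpa using hη)⟩
    have h0 : ∑' i, ⟪ξ i, ((0 : M.toStarSubalgebra) : H →L[ℂ] H) (η i)⟫_ℂ = 0 := by simp
    rw [h0]
    refine (hT ξ' η').congr fun a => ?_
    rw [lp.inner_eq_tsum]
    rfl
  have hc := (@Continuous.tendsto _ _ (TopologicalSpace.induced
    (fun a : M.toStarSubalgebra => (a : H →L[ℂ] H)) (ultraweakTopology H)) _ _ hτ.normal 0).comp ht
  rwa [map_zero] at hc

/-- A functional continuous for the ultraweak topology is small at `(g - a)* (g - a)` for suitable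
elements `a` of a `*`-algebra whose double commutant contains `g`. -/
lemma exists_norm_apply_lt (M : VonNeumannAlgebra H) (τ : M.toStarSubalgebra →ₗ[ℂ] ℂ)
    (hτ : IsTracialState M τ) (S : StarSubalgebra ℂ (H →L[ℂ] H)) (hS : S ≤ M.toStarSubalgebra)
    (g : M.toStarSubalgebra)
    (hg : (g : H →L[ℂ] H) ∈ Set.centralizer (Set.centralizer (S : Set (H →L[ℂ] H))))
    {δ : ℝ} (hδ : 0 < δ) :
    ∃ a : M.toStarSubalgebra, (a : H →L[ℂ] H) ∈ S ∧ ‖τ (star (g - a) * (g - a))‖ < δ := by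
  -- the filter of elements of `S` approaching `g` in the ultrastrong topology
  let 𝓕 : Filter M.toStarSubalgebra := ⨅ q : EllTwo H × {δ : ℝ // 0 < δ},
    𝓟 {a | (a : H →L[ℂ] H) ∈ S ∧ ‖amplify q.1 ((g : H →L[ℂ] H) - a)‖ < q.2}
  have hne : 𝓕.NeBot := by
    refine iInf_neBot_of_directed ?_ fun q => ?_
    · intro q q'
      obtain ⟨ζ, hζ⟩ := exists_norm_amplify_le q.1 q'.1
      refine ⟨(ζ, ⟨min q.2 q'.2, lt_min q.2.2 q'.2.2⟩), principal_mono.2 fun a h => ?_,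
        principal_mono.2 fun a h => ?_⟩
      · exact ⟨h.1, (hζ _).1.trans_lt (h.2.trans_le (min_le_left _ _))⟩
      · exact ⟨h.1, (hζ _).2.trans_lt (h.2.trans_le (min_le_right _ _))⟩
    · obtain ⟨a, ha, h⟩ := exists_amplify_sub_lt S hg q.1 q.2.2
      exact principal_neBot_iff.2 ⟨⟨a, hS ha⟩, ha, h⟩
  have hmem (ξ : EllTwo H) {ε : ℝ} (hε : 0 < ε) :
      ∀ᶠ a : M.toStarSubalgebra in 𝓕,
        (a : H →L[ℂ] H) ∈ S ∧ ‖amplify ξ ((g : H →L[ℂ] H) - (a : H →L[ℂ] H))‖ < ε :=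
    mem_iInf_of_mem (ξ, ⟨ε, hε⟩) (mem_principal_self _)
  have hlim (ξ : EllTwo H) :
      Tendsto (fun a => amplify ξ ((g : H →L[ℂ] H) - (a : M.toStarSubalgebra))) 𝓕 (𝓝 0) := by
    rw [Metric.tendsto_nhds]
    intro ε hε
    filter_upwards [hmem ξ hε] with a ha
    simpa using ha.2
  have hc : Tendsto (fun a => τ (star (g - a) * (g - a))) 𝓕 (𝓝 0) := by
    refine hτ.tendsto_zero fun ξ η => ?_
    have h := (hlim ξ).inner (𝕜 := ℂ) (hlim η)
    rw [inner_zero_left] at h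
    refine h.congr fun a => ?_
    rw [inner_amplify_left]
    rfl
  have hsmall : ∀ᶠ a in 𝓕, ‖τ (star (g - a) * (g - a))‖ < δ := by
    have := hc.norm
    rw [norm_zero] at this
    exact this.eventually_lt_const hδ
  obtain ⟨a, h1, h2⟩ := (hsmall.and (hmem 0 one_pos)).exists
  exact ⟨a, h2.1, h1⟩

lemma isClosed_vonNeumannAlgebra (M : VonNeumannAlgebra H) :
    IsClosed (M.toStarSubalgebra : Set (H →L[ℂ] H)) := by
  have h : (M.toStarSubalgebra : Set (H →L[ℂ] H))
      = Set.centralizer (Set.centralizer (M : Set (H →L[ℂ] H))) :=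
    M.centralizer_centralizer.symm
  rw [h]
  exact Set.isClosed_centralizer _

/-- The C⋆-algebra structure of a von Neumann algebra. It is only a local instance, so that types
such as that of `theorem6` keep the algebraic structures of a star subalgebra. -/
@[reducible]
def cstarAlgebraVonNeumann (M : VonNeumannAlgebra H) : CStarAlgebra M.toStarSubalgebra :=
  StarSubalgebra.cstarAlgebra M.toStarSubalgebra (h_closed := isClosed_vonNeumannAlgebra M)

attribute [local instance] cstarAlgebraVonNeumann

lemma IsTracialState.isTrace {M : VonNeumannAlgebra H} {τ : M.toStarSubalgebra →ₗ[ℂ] ℂ}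
    (hτ : IsTracialState M τ) : IsTrace τ where
  map_one := hτ.map_one
  nonneg := hτ.nonneg
  tracial := hτ.tracial

lemma StarPoly.coe_eval {M : VonNeumannAlgebra H} {ι : Type} (y : ι → M.toStarSubalgebra)
    (P : StarPoly ι) :
    ((P.eval y : M.toStarSubalgebra) : H →L[ℂ] H) = P.eval fun i => (y i : H →L[ℂ] H) := by
  induction P with
  | var i => rfl
  | const c => rfl
  | add P Q hP hQ => simp only [StarPoly.eval, ← hP, ← hQ]; rfl
  | mul P Q hP hQ => simp only [StarPoly.eval, ← hP, ← hQ]; rfl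
  | adj P hP => simp only [StarPoly.eval, ← hP]; rfl

/-- The `*`-algebra of values of `*`-polynomials at a family of operators. -/
def polyAlgebra {ι : Type} (y : ι → H →L[ℂ] H) : StarSubalgebra ℂ (H →L[ℂ] H) where
  carrier := Set.range (StarPoly.eval y)
  mul_mem' := by rintro _ _ ⟨P, rfl⟩ ⟨Q, rfl⟩; exact ⟨P.mul Q, rfl⟩
  add_mem' := by rintro _ _ ⟨P, rfl⟩ ⟨Q, rfl⟩; exact ⟨P.add Q, rfl⟩
  algebraMap_mem' c := ⟨.const c, rfl⟩
  star_mem' := by rintro _ ⟨P, rfl⟩; exact ⟨P.adj, rfl⟩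

/-- The double commutant of a `*`-algebra, as a von Neumann algebra. -/
def doubleCommutant (S : StarSubalgebra ℂ (H →L[ℂ] H)) : VonNeumannAlgebra H where
  toStarSubalgebra := StarSubalgebra.centralizer ℂ
    (StarSubalgebra.centralizer ℂ (S : Set (H →L[ℂ] H)) : Set (H →L[ℂ] H))
  centralizer_centralizer' := by
    change Set.centralizer (Set.centralizer (Set.centralizer _)) = Set.centralizer _
    rw [Set.centralizer_centralizer_centralizer]

lemma mem_doubleCommutant {S : StarSubalgebra ℂ (H →L[ℂ] H)} {g : H →L[ℂ] H} :
    g ∈ doubleCommutant S ↔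
      g ∈ Set.centralizer (Set.centralizer (S : Set (H →L[ℂ] H))) := by
  have h : ((doubleCommutant S).toStarSubalgebra : Set (H →L[ℂ] H))
      = Set.centralizer (Set.centralizer (S : Set (H →L[ℂ] H))) := by
    rw [doubleCommutant, StarSubalgebra.coe_centralizer_centralizer, StarMemClass.star_coe_eq,
      Set.union_self]
  exact Set.ext_iff.1 h g

/-- The `*`-polynomials in a generating family are `2`-norm dense. -/
theorem exists_twoNorm_sub_eval_le {M : VonNeumannAlgebra H} {τ : M.toStarSubalgebra →ₗ[ℂ] ℂ}
    (hτ : IsTracialState M τ) {ι : Type} {y : ι → M.toStarSubalgebra}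
    (hy : IsGeneratedBy M (Set.range fun j => (y j : H →L[ℂ] H))) (g : M.toStarSubalgebra)
    {δ : ℝ} (hδ : 0 < δ) : ∃ Q : StarPoly ι, twoNorm τ (g - Q.eval y) ≤ δ := by
  set S := polyAlgebra fun j => (y j : H →L[ℂ] H)
  have hS : S ≤ M.toStarSubalgebra := by
    rintro _ ⟨P, rfl⟩
    rw [← StarPoly.coe_eval]
    exact (P.eval y).2
  have hMS : M ≤ doubleCommutant S := by
    refine hy.2 ?_
    rintro _ ⟨j, rfl⟩
    exact mem_doubleCommutant.2 (Set.subset_centralizer_centralizer ⟨.var j, rfl⟩)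
  obtain ⟨a, ⟨Q, hQ⟩, h⟩ := exists_norm_apply_lt M τ hτ S hS g (mem_doubleCommutant.1 (hMS g.2))
    (by positivity : 0 < δ ^ 2)
  have ha : a = Q.eval y := Subtype.ext (by rw [StarPoly.coe_eval]; exact hQ.symm)
  refine ⟨Q, ?_⟩
  rw [← ha, twoNorm]
  exact Real.sqrt_le_iff.2 ⟨hδ.le, ((le_abs_self _).trans (Complex.abs_re_le_norm _)).trans h.le⟩

/-! ### Small projections in diffuse von Neumann algebras -/

variable {M N : VonNeumannAlgebra H} {τ : M.toStarSubalgebra →ₗ[ℂ] ℂ}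

/-- The projections of `M` lying in the von Neumann subalgebra `N`. -/
def projIn (M N : VonNeumannAlgebra H) : Set M.toStarSubalgebra :=
  {p | (p : H →L[ℂ] H) ∈ N ∧ IsStarProjection p}

lemma isStarProjection_coe {p : M.toStarSubalgebra} :
    IsStarProjection (p : H →L[ℂ] H) ↔ IsStarProjection p := by
  simp only [isStarProjection_iff']
  exact and_congr (Subtype.ext_iff (a1 := p * p) (a2 := p)).symm
    (Subtype.ext_iff (a1 := star p) (a2 := p)).symm

lemma zero_mem_projIn : (0 : M.toStarSubalgebra) ∈ projIn M N :=
  ⟨zero_mem N, .zero _⟩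

lemma one_sub_mem_projIn {p : M.toStarSubalgebra} (hp : p ∈ projIn M N) : 1 - p ∈ projIn M N :=
  ⟨sub_mem (one_mem N) hp.1, hp.2.one_sub⟩

lemma add_mem_projIn {p q : M.toStarSubalgebra} (hp : p ∈ projIn M N) (hq : q ∈ projIn M N)
    (h : p * q = 0) : p + q ∈ projIn M N :=
  ⟨add_mem hp.1 hq.1, hp.2.add hq.2 h⟩

lemma IsTracialState.re_eq_twoNorm_sq (hτ : IsTracialState M τ) {p : M.toStarSubalgebra}
    (hp : IsStarProjection p) : (τ p).re = twoNorm τ p ^ 2 := by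
  rw [hτ.isTrace.twoNorm_sq, hp.isSelfAdjoint.star_eq, hp.isIdempotentElem.eq]

lemma IsTracialState.re_nonneg (hτ : IsTracialState M τ) {p : M.toStarSubalgebra}
    (hp : IsStarProjection p) : 0 ≤ (τ p).re := by
  rw [hτ.re_eq_twoNorm_sq hp]; positivity

lemma IsTracialState.re_pos (hτ : IsTracialState M τ) {p : M.toStarSubalgebra}
    (hp : IsStarProjection p) (h0 : p ≠ 0) : 0 < (τ p).re := by
  refine lt_of_le_of_ne (hτ.re_nonneg hp) fun h => h0 (hτ.faithful p ?_)
  have h1 := hτ.nonneg p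
  rw [hp.isSelfAdjoint.star_eq, hp.isIdempotentElem.eq] at h1 ⊢
  exact Complex.ext h.symm (Complex.nonneg_iff.1 h1).2.symm

/-- Repeated halving: in a diffuse algebra every nonzero projection has a nonzero subprojection of
small trace. -/
lemma exists_small_subprojection (hτ : IsTracialState M τ) (hNM : N ≤ M) (hN : IsDiffuse N)
    {p : M.toStarSubalgebra} (hp : p ∈ projIn M N) (hp0 : p ≠ 0) {δ : ℝ} (hδ : 0 < δ) :
    ∃ q ∈ projIn M N, q * p = q ∧ q ≠ 0 ∧ (τ q).re ≤ δ := by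
  have half (n : ℕ) : ∃ q ∈ projIn M N, q * p = q ∧ q ≠ 0 ∧ (τ q).re ≤ (1 / 2) ^ n * (τ p).re := by
    induction n with
    | zero => exact ⟨p, hp, hp.2.isIdempotentElem.eq, hp0, by simp⟩
    | succ n ih =>
      obtain ⟨q, hq, hqp, hq0, hqt⟩ := ih
      obtain ⟨s', hsN, hs', hsq', hs0', hsne'⟩ := hN q hq.1 (isStarProjection_coe.2 hq.2)
        (fun h => hq0 (Subtype.ext h))
      set s : M.toStarSubalgebra := ⟨s', hNM hsN⟩
      have hs : IsStarProjection s := isStarProjection_coe.1 hs'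
      have hsq : s * q = s := Subtype.ext hsq'
      have hs0 : s ≠ 0 := fun h => hs0' (congrArg Subtype.val h)
      have hsne : q - s ≠ 0 := fun h => hsne' (congrArg Subtype.val (sub_eq_zero.1 h)).symm
      have hd : IsStarProjection (q - s) := hs.sub_of_mul_eq_left hq.2 hsq
      have hsum : (τ q).re = (τ s).re + (τ (q - s)).re := by
        rw [map_sub, Complex.sub_re]; ring
      rw [pow_succ]
      rcases le_total (τ s).re (τ (q - s)).re with h | h
      · exact ⟨s, ⟨hsN, hs⟩, by rw [← hsq, mul_assoc, hqp], hs0, by linarith⟩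
      · refine ⟨q - s, ⟨sub_mem hq.1 hsN, hd⟩, ?_, hsne, by linarith⟩
        rw [sub_mul, hqp, ← hsq, mul_assoc, hqp]
  have ht := hτ.re_pos hp.2 hp0
  obtain ⟨n, hn⟩ := exists_pow_lt_of_lt_one (div_pos hδ ht) (by norm_num : (1 / 2 : ℝ) < 1)
  obtain ⟨q, hq, h1, h2, h3⟩ := half n
  exact ⟨q, hq, h1, h2, h3.trans ((lt_div_iff₀ ht).1 hn).le⟩

/-- The supremum of an increasing sequence of projections, with strong convergence. -/
lemma exists_sup_projIn (hNM : N ≤ M) {p : ℕ → M.toStarSubalgebra} (hp : ∀ n, p n ∈ projIn M N)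
    (hmono : ∀ n, p (n + 1) * p n = p n) :
    ∃ P ∈ projIn M N, (∀ n, P * p n = p n) ∧
      ∀ v : H, Tendsto (fun n => (p n : H →L[ℂ] H) v) atTop (𝓝 ((P : H →L[ℂ] H) v)) := by
  have hrange (n) : ∃ _ : (p n : H →L[ℂ] H).range.HasOrthogonalProjection,
      (p n : H →L[ℂ] H) = (p n : H →L[ℂ] H).range.starProjection :=
    isStarProjection_iff_eq_starProjection_range.1 (isStarProjection_coe.2 (hp n).2)
  choose hproj hpr using hrange
  let U (n : ℕ) : Submodule ℂ H := (p n : H →L[ℂ] H).range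
  have hU : Monotone U := by
    refine monotone_nat_of_le_succ fun n => ?_
    rintro _ ⟨v, rfl⟩
    exact ⟨(p n : H →L[ℂ] H) v,
      congrArg (fun T : M.toStarSubalgebra => (T : H →L[ℂ] H) v) (hmono n)⟩
  let V := (⨆ n, U n).topologicalClosure
  have : CompleteSpace V := (Submodule.isClosed_topologicalClosure _).completeSpace_coe
  have hPN : V.starProjection ∈ N := by
    rw [VonNeumannAlgebra.IsStarProjection.mem_iff isStarProjection_starProjection]
    intro T hT
    rw [Submodule.range_starProjection]
    have hle : (⨆ n, U n) ≤ (⨆ n, U n).comap (T : H →ₗ[ℂ] H) := iSup_le fun n => by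
      rintro _ ⟨v, rfl⟩
      refine Submodule.mem_iSup_of_mem n ⟨T v, ?_⟩
      exact congrArg (fun S : H →L[ℂ] H => S v)
        (VonNeumannAlgebra.mem_commutant_iff.1 hT _ (hp n).1)
    exact fun v hv => map_mem_closure T.continuous hv fun w hw => hle hw
  refine ⟨⟨V.starProjection, hNM hPN⟩,
    ⟨hPN, isStarProjection_coe.1 isStarProjection_starProjection⟩,
    fun n => Subtype.ext (ContinuousLinearMap.ext fun v => ?_), fun v => ?_⟩
  · refine Submodule.starProjection_eq_self_iff.2 ?_
    exact Submodule.le_topologicalClosure _ (le_iSup U n ⟨v, rfl⟩)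
  · have h := Submodule.starProjection_tendsto_closure_iSup U hU v
    refine h.congr fun n => ?_
    exact (congrArg (fun T : H →L[ℂ] H => T v) (hpr n)).symm

/-- Normality of the trace along a sequence of projections that converges strongly to `0`. -/
lemma IsTracialState.tendsto_zero_of_strong (hτ : IsTracialState M τ)
    {p : ℕ → M.toStarSubalgebra} (hp : ∀ n, IsStarProjection (p n))
    (h : ∀ v : H, Tendsto (fun n => (p n : H →L[ℂ] H) v) atTop (𝓝 0)) :
    Tendsto (fun n => τ (p n)) atTop (𝓝 0) := by
  refine hτ.tendsto_zero fun ξ η => ?_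
  have h0 : Tendsto (fun n => amplify η (p n : H →L[ℂ] H)) atTop (𝓝 0) := by
    rw [tendsto_zero_iff_norm_tendsto_zero]
    have hsq : Tendsto (fun n => ‖amplify η (p n : H →L[ℂ] H)‖ ^ 2) atTop (𝓝 0) := by
      simp only [EllTwo.norm_sq, amplify_apply]
      have e : (0 : ℝ) = ∑' _ : ℕ, (0 : ℝ) := by simp
      rw [e]
      refine tendsto_tsum_of_dominated_convergence η.summable_norm_sq (fun i => ?_)
        (Eventually.of_forall fun n i => ?_)
      · have := ((h (η i)).norm).pow 2
        simpa using this
      · rw [Real.norm_of_nonneg (by positivity)]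
        refine pow_le_pow_left₀ (norm_nonneg _) ?_ 2
        refine ((p n : H →L[ℂ] H).le_opNorm _).trans (mul_le_of_le_one_left (norm_nonneg _) ?_)
        exact (isStarProjection_coe.2 (hp n)).norm_le _
    have := hsq.sqrt
    simpa [Real.sqrt_sq] using this
  simpa using (tendsto_const_nhds (x := ξ)).inner (𝕜 := ℂ) h0

/-- `p` is a finite sum of projections of `N` with traces at most `δ`. -/
def IsFineSum (N : VonNeumannAlgebra H) (τ : M.toStarSubalgebra →ₗ[ℂ] ℂ) (δ : ℝ)
    (p : M.toStarSubalgebra) : Prop :=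
  ∃ (r : ℕ) (e : Fin r → M.toStarSubalgebra),
    (∀ l, e l ∈ projIn M N ∧ (τ (e l)).re ≤ δ) ∧ ∑ l, e l = p

lemma IsFineSum.add {δ : ℝ} {p q : M.toStarSubalgebra} (hp : IsFineSum N τ δ p)
    (hq : q ∈ projIn M N) (hqδ : (τ q).re ≤ δ) : IsFineSum N τ δ (p + q) := by
  obtain ⟨r, e, he, rfl⟩ := hp
  refine ⟨r + 1, Fin.snoc e q, fun l => ?_, by simp [Fin.sum_univ_castSucc]⟩
  refine Fin.lastCases ?_ (fun l => ?_) l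
  · simpa using ⟨hq, hqδ⟩
  · simpa using he l

/-- In a diffuse algebra the unit is a finite sum of projections of arbitrarily small trace. Small
projections are split off one after the other, each with at least half of the largest possible
trace; by normality and faithfulness they exhaust the unit up to a remainder of small trace. -/
theorem isFineSum_one (hτ : IsTracialState M τ) (hNM : N ≤ M) (hN : IsDiffuse N) {δ : ℝ}
    (hδ : 0 < δ) : IsFineSum N τ δ 1 := by
  let good (p q : M.toStarSubalgebra) : Prop :=
    q ∈ projIn M N ∧ q * (1 - p) = q ∧ (τ q).re ≤ δ
  have step (p : M.toStarSubalgebra) : ∃ q, good p q ∧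
      ∀ q', good p q' → (τ q').re ≤ 2 * (τ q).re := by
    have h0 : good p 0 := ⟨zero_mem_projIn, by simp, by simpa using hδ.le⟩
    set T := (fun q => (τ q).re) '' {q | good p q}
    have hbdd : BddAbove T := ⟨δ, by rintro _ ⟨q, hq, rfl⟩; exact hq.2.2⟩
    have hle (q') (hq' : good p q') : (τ q').re ≤ sSup T := le_csSup hbdd ⟨q', hq', rfl⟩
    rcases (hle 0 h0).lt_or_eq with hpos | hzero
    · simp only [map_zero, Complex.zero_re] at hpos
      obtain ⟨_, ⟨q, hq, rfl⟩, hlt⟩ := exists_lt_of_lt_csSup (s := T) ⟨_, 0, h0, rfl⟩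
        (half_lt_self hpos)
      exact ⟨q, hq, fun q' hq' => by linarith [hle q' hq']⟩
    · refine ⟨0, h0, fun q' hq' => ?_⟩
      have := hle q' hq'
      rw [← hzero] at this
      simpa using this
  choose q hq hmax using step
  let p : ℕ → M.toStarSubalgebra := fun n => Nat.rec 0 (fun _ p => p + q p) n
  have psucc (n) : p (n + 1) = p n + q (p n) := rfl
  have horth (n) (hn : p n ∈ projIn M N) : q (p n) * p n = 0 := by
    have h := (hq (p n)).2.1
    rw [← h, mul_assoc, hn.2.one_sub_mul_self, mul_zero]
  have horth' (n) (hn : p n ∈ projIn M N) : p n * q (p n) = 0 := by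
    have h := congrArg star (horth n hn)
    rwa [star_mul, hn.2.isSelfAdjoint.star_eq, (hq (p n)).1.2.isSelfAdjoint.star_eq,
      star_zero] at h
  have hp (n) : p n ∈ projIn M N := by
    induction n with
    | zero => exact zero_mem_projIn
    | succ n ih => exact add_mem_projIn ih (hq _).1 (horth' n ih)
  have hfine (n) : IsFineSum N τ δ (p n) := by
    induction n with
    | zero => exact ⟨0, Fin.elim0, fun l => l.elim0, by simp [p]⟩
    | succ n ih => exact ih.add (hq _).1 (hq _).2.2
  -- the traces of the split-off projections are summable
  have hsum (n) : (τ (p n)).re = ∑ i ∈ Finset.range n, (τ (q (p i))).re := by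
    induction n with
    | zero => simp [p]
    | succ n ih => rw [psucc, map_add, Complex.add_re, ih, Finset.sum_range_succ]
  have hle1 (n) : (τ (p n)).re ≤ 1 := by
    have := hτ.re_nonneg (one_sub_mem_projIn (hp n)).2
    rw [map_sub, hτ.map_one, Complex.sub_re, Complex.one_re] at this
    linarith
  have hq0 : Tendsto (fun n => (τ (q (p n))).re) atTop (𝓝 0) := by
    refine (summable_of_sum_range_le (c := 1) (fun n => hτ.re_nonneg (hq (p n)).1.2)
      fun n => ?_).tendsto_atTop_zero
    rw [← hsum]; exact hle1 n
  obtain ⟨P, hP, hPp, hPlim⟩ := exists_sup_projIn hNM hp fun n => by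
    rw [psucc, add_mul, horth n (hp n), add_zero, (hp n).2.isIdempotentElem.eq]
  have hP1 : P = 1 := by
    by_contra hne
    obtain ⟨s, hs, hsP, hs0, hsδ⟩ := exists_small_subprojection hτ hNM hN
      (one_sub_mem_projIn hP) (sub_ne_zero.2 (Ne.symm hne)) hδ
    have hgood (n) : good (p n) s := by
      refine ⟨hs, ?_, hsδ⟩
      have : (1 - P) * (1 - p n) = 1 - P := by
        simp only [mul_sub, sub_mul, one_mul, mul_one, hPp]
        abel
      rw [← hsP, mul_assoc, this]
    have h1 := ge_of_tendsto (hq0.const_mul 2)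
      (Eventually.of_forall fun n => hmax (p n) s (hgood n))
    have := hτ.re_pos hs.2 hs0
    linarith
  have hlim : Tendsto (fun n => τ (1 - p n)) atTop (𝓝 0) := by
    refine hτ.tendsto_zero_of_strong (fun n => (one_sub_mem_projIn (hp n)).2) fun v => ?_
    have h := (tendsto_const_nhds (x := v)).sub (hPlim v)
    rw [hP1] at h
    simpa using h
  have hlim' : Tendsto (fun n => (τ (1 - p n)).re) atTop (𝓝 0) := by
    have := (Complex.continuous_re.tendsto 0).comp hlim
    rwa [Complex.zero_re] at this
  obtain ⟨n, hn⟩ := (hlim'.eventually_lt_const hδ).exists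
  have := (hfine n).add (one_sub_mem_projIn (hp n)) hn.le
  rwa [add_sub_cancel] at this

/-- In a diffuse algebra there are finite partitions of unity into projections for which the
sum of the squares of the traces is arbitrarily small. -/
lemma exists_fine_partition (hτ : IsTracialState M τ) (hNM : N ≤ M) (hN : IsDiffuse N) {β : ℝ}
    (hβ : 0 < β) : ∃ (r : ℕ) (e : Fin r → M.toStarSubalgebra), (∀ l, e l ∈ projIn M N) ∧
      ∑ l, e l = 1 ∧ ∑ l, twoNorm τ (e l) ^ 4 ≤ β := by
  obtain ⟨r, e, he, hsum⟩ := isFineSum_one hτ hNM hN hβ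
  refine ⟨r, e, fun l => (he l).1, hsum, ?_⟩
  calc ∑ l, twoNorm τ (e l) ^ 4 ≤ ∑ l, β * (τ (e l)).re := by
        refine Finset.sum_le_sum fun l _ => ?_
        have h1 := hτ.re_eq_twoNorm_sq (he l).1.2
        have h2 := hτ.re_nonneg (he l).1.2
        calc twoNorm τ (e l) ^ 4 = (τ (e l)).re * (τ (e l)).re := by rw [h1]; ring
          _ ≤ β * (τ (e l)).re := mul_le_mul_of_nonneg_right (he l).2 h2
    _ = β := by
        rw [← Finset.mul_sum, ← Complex.re_sum, ← map_sum, hsum, hτ.map_one]; simp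

/-! ### Passing between a von Neumann algebra and its subalgebras -/

lemma IsTracialState.nontrivial (hτ : IsTracialState M τ) : Nontrivial M.toStarSubalgebra :=
  ⟨1, 0, fun h => one_ne_zero (α := ℂ) (by rw [← hτ.map_one, h, map_zero])⟩

/-- The inclusion of a von Neumann subalgebra. -/
def inclusion (h : N ≤ M) : N.toStarSubalgebra →⋆ₐ[ℂ] M.toStarSubalgebra :=
  StarSubalgebra.inclusion h

lemma IsTracialState.restrictTo (hτ : IsTracialState M τ) (h : N ≤ M) :
    IsTracialState N (restrictTo h τ) where
  map_one := hτ.map_one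
  nonneg a := hτ.nonneg (inclusion h a)
  faithful a ha :=
    Subtype.ext (congrArg (fun b : M.toStarSubalgebra => (b : H →L[ℂ] H))
      (hτ.faithful (inclusion h a) ha))
  tracial a b := hτ.tracial (inclusion h a) (inclusion h b)
  normal := by
    let := TopologicalSpace.induced (fun a : M.toStarSubalgebra => (a : H →L[ℂ] H))
      (ultraweakTopology H)
    let := TopologicalSpace.induced (fun a : N.toStarSubalgebra => (a : H →L[ℂ] H))
      (ultraweakTopology H)
    have hc : Continuous (inclusion h) := continuous_induced_rng.2 continuous_induced_dom
    exact hτ.normal.comp hc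

lemma starWord_inclusion (h : N ≤ M) {p : ℕ} (x : Fin p → N.toStarSubalgebra)
    (w : List (Fin p × Bool)) :
    starWord (fun j => inclusion h (x j)) w = inclusion h (starWord x w) := by
  simp only [starWord, map_list_prod, List.map_map]
  congr 1
  refine List.map_congr_left fun a _ => ?_
  simp only [Function.comp_apply]
  split_ifs
  · rw [map_star]
  · rfl

lemma microstates_inclusion (h : N ≤ M) {p : ℕ} (x : Fin p → N.toStarSubalgebra) :
    microstates τ (fun j => inclusion h (x j)) = microstates (restrictTo h τ) x := by
  funext R m k ε
  simp only [microstates, starWord_inclusion]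
  rfl

lemma NegligibleOrbits.map_inclusion (h : N ≤ M) {p : ℕ} {x : Fin p → N.toStarSubalgebra}
    (hx : NegligibleOrbits (restrictTo h τ) x) :
    NegligibleOrbits τ fun j => inclusion h (x j) := by
  unfold NegligibleOrbits at hx ⊢
  simpa only [microstates_inclusion] using hx

lemma BoundedApprox.map_inclusion (h : N ≤ M) {p : ℕ} {x : Fin p → N.toStarSubalgebra}
    {a : N.toStarSubalgebra} (ha : BoundedApprox (restrictTo h τ) x a) :
    BoundedApprox τ (fun j => inclusion h (x j)) (inclusion h a) := by
  have heval (P : StarPoly (Fin p)) :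
      P.eval (fun j => inclusion h (x j)) = inclusion h (P.eval x) :=
    Subtype.ext ((StarPoly.coe_eval _ P).trans (StarPoly.coe_eval x P).symm)
  obtain ⟨C, hC⟩ := ha
  refine ⟨C, fun R hR δ hδ => ?_⟩
  obtain ⟨P, h1, h2, h3⟩ := hC R hR δ hδ
  refine ⟨P, ?_, ?_, h3⟩
  · rw [heval]; exact h1
  · rw [heval]; exact h2

/-- A von Neumann subalgebra with vanishing upper free orbit-dimension has a finite family `x` of
generators whose microstates have negligibly many orbits, and every element of the subalgebra is a
bounded limit of `*`-polynomials in `x`. -/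
lemma exists_generators (hτ : IsTracialState M τ) (h : N ≤ M)
    (hK : upperFreeOrbitDimension N (restrictTo h τ) = 0) :
    ∃ (p : ℕ) (x : Fin p → M.toStarSubalgebra),
      IsGeneratedBy N (Set.range fun j => (x j : H →L[ℂ] H)) ∧ NegligibleOrbits τ x ∧
        ∀ a : M.toStarSubalgebra, (a : H →L[ℂ] H) ∈ N → BoundedApprox τ x a := by
  obtain ⟨p, x, hx⟩ : ∃ (p : ℕ) (x : Fin p → N.toStarSubalgebra),
      IsGeneratedBy N (Set.range fun j => (x j : H →L[ℂ] H)) := by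
    by_contra! hne
    simp [upperFreeOrbitDimension, hne] at hK
  have hle : upperOrbitDim (restrictTo h τ) x ≤ 0 := by
    rw [← hK]
    exact le_iSup_of_le p (le_iSup_of_le x (le_iSup_of_le hx le_rfl))
  have hτN := hτ.restrictTo h
  have := hτN.nontrivial
  refine ⟨p, fun j => inclusion h (x j), hx,
    (negligibleOrbits_of_upperOrbitDim_le_zero hle).map_inclusion h, fun a ha => ?_⟩
  exact (boundedApprox_of_dense hτN.isTrace
    (fun g δ hδ => exists_twoNorm_sub_eval_le hτN hx g hδ) ⟨a, ha⟩).map_inclusion h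

lemma isGeneratedBy_sumElim {N₁ N₂ : VonNeumannAlgebra H}
    (hgen : IsGeneratedBy M ((N₁ : Set (H →L[ℂ] H)) ∪ (N₂ : Set (H →L[ℂ] H)))) {ι κ : Type}
    {x : ι → M.toStarSubalgebra} {z : κ → M.toStarSubalgebra}
    (hx : IsGeneratedBy N₁ (Set.range fun j => (x j : H →L[ℂ] H)))
    (hz : IsGeneratedBy N₂ (Set.range fun j => (z j : H →L[ℂ] H))) :
    IsGeneratedBy M (Set.range fun j => ((Sum.elim x z j : M.toStarSubalgebra) : H →L[ℂ] H)) := by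
  refine ⟨?_, fun P hP => hgen.2 (Set.union_subset (hx.2 ?_) (hz.2 ?_))⟩
  · rintro _ ⟨j, rfl⟩
    exact (Sum.elim x z j).2
  · rintro _ ⟨j, rfl⟩
    exact hP ⟨.inl j, rfl⟩
  · rintro _ ⟨j, rfl⟩
    exact hP ⟨.inr j, rfl⟩

/-- The upper bound is `negligibleOrbits_of_amalgam` for an arbitrary generating family of `M`. The
lower bound needs that some finite generating family exists, as an empty supremum is `⊥`. -/
theorem upperFreeOrbitDimension_eq_zero {N₁ N₂ : VonNeumannAlgebra H} (hτ : IsTracialState M τ)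
    (h₁ : N₁ ≤ M) (h₂ : N₂ ≤ M)
    (hgen : IsGeneratedBy M ((N₁ : Set (H →L[ℂ] H)) ∪ (N₂ : Set (H →L[ℂ] H))))
    (hK₁ : upperFreeOrbitDimension N₁ (restrictTo h₁ τ) = 0)
    (hK₂ : upperFreeOrbitDimension N₂ (restrictTo h₂ τ) = 0)
    (hdiff : IsDiffuse (inter N₁ N₂)) : upperFreeOrbitDimension M τ = 0 := by
  have := hτ.nontrivial
  obtain ⟨p, x, hx, hnx, hbx⟩ := exists_generators hτ h₁ hK₁
  obtain ⟨q, z, hz, hnz, hbz⟩ := exists_generators hτ h₂ hK₂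
  have hxz := isGeneratedBy_sumElim hgen hx hz
  refine le_antisymm (iSup_le fun n => iSup_le fun y => iSup_le fun hy => ?_) ?_
  · have hb (a : M.toStarSubalgebra) : BoundedApprox τ y a :=
      boundedApprox_of_dense hτ.isTrace
        (fun g δ hδ => exists_twoNorm_sub_eval_le hτ hy g hδ) a
    refine upperOrbitDim_le_zero (negligibleOrbits_of_amalgam hτ.isTrace (fun j => hb (x j))
      (fun j => hb (z j)) (fun j δ hδ => exists_twoNorm_sub_eval_le hτ hxz (y j) hδ)
      (fun β hβ => ?_) hnx hnz)
    obtain ⟨r, e, he, hsum, hβe⟩ := exists_fine_partition hτ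
      (N := inter N₁ N₂) (fun a ha => h₁ ha.1) hdiff hβ
    exact ⟨r, e, fun l => (he l).2, hsum, hβe,
      fun l => ⟨hbx _ (he l).1.1, hbz _ (he l).1.2⟩⟩
  · have hgen' : IsGeneratedBy M (Set.range fun j =>
        ((Sum.elim x z (finSumFinEquiv.symm j) : M.toStarSubalgebra) : H →L[ℂ] H)) := by
      have e := finSumFinEquiv.symm.surjective.range_comp
        fun j => ((Sum.elim x z j : M.toStarSubalgebra) : H →L[ℂ] H)
      exact e ▸ hxz
    exact le_iSup_of_le _ (le_iSup_of_le _ (le_iSup_of_le hgen' (upperOrbitDim_nonneg _ _)))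

end

end FreeOrbit

theorem theorem6 {H : Type*} [NormedAddCommGroup H] [InnerProductSpace ℂ H] [CompleteSpace H]
    (M N₁ N₂ : VonNeumannAlgebra H) (τ : M.toStarSubalgebra →ₗ[ℂ] ℂ)
    (hτ : FreeOrbit.IsTracialState M τ)
    (h₁ : N₁ ≤ M) (h₂ : N₂ ≤ M)
    (hgen : FreeOrbit.IsGeneratedBy M ((N₁ : Set (H →L[ℂ] H)) ∪ (N₂ : Set (H →L[ℂ] H))))
    (hK₁ : FreeOrbit.upperFreeOrbitDimension N₁ (FreeOrbit.restrictTo h₁ τ) = 0)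
    (hK₂ : FreeOrbit.upperFreeOrbitDimension N₂ (FreeOrbit.restrictTo h₂ τ) = 0)
    (hdiff : FreeOrbit.IsDiffuse (FreeOrbit.inter N₁ N₂)) :
    FreeOrbit.upperFreeOrbitDimension M τ = 0 :=
  FreeOrbit.upperFreeOrbitDimension_eq_zero hτ h₁ h₂ hgen hK₁ hK₂ hdiff
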